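/- Let $\mathcal O_S=\mathbb C\{x_1,\dots,x_n\}$ be the ring of convergent power series, i.e. the local ring of the germ $S=(\mathbb C^n,0)$, and let $\Theta_S=\mathrm{Der}_{\mathbb C}(\mathcal O_S)$. Let $0\neq h\in\mathcal O_S$ define a reduced divisor $D$, that is, $\mathcal O_D=\mathcal O_S/\mathcal O_S h$ is a reduced ring, and let $\mathcal M_D$ be the total ring of fractions of $\mathcal O_D$. Put $$\mathrm{Der}(-\log D)=\{\delta\in\Theta_S\mid \delta(h)\in\mathcal O_S h\},$$ $$\Omega^1(\log D)=\{\omega\in h^{-1}\Omega^1_S\mid d\omega\in h^{-1}\Omega^2_S\},$$ where $\Omega^p_S$ denotes the $\mathcal O_S$-module of holomorphic $p$-forms on $S$. Let $\mathcal R_D\subseteq\mathcal M_D$ be the $\mathcal O_D$-module of residues of logarithmic $1$-forms: the elements $\frac{\xi}{g}\big|_D$, where $\omega=\frac{dh}{h}\,\frac{\xi}{g}+\frac{\eta}{g}\in\Omega^1(\log D)$ with $\xi,g\in\mathcal O_S$, $\eta\in\Omega^1_S$, and $g$ restricting to a non-zero divisor in $\mathcal O_D$. Let $\mathcal J_D\subseteq\mathcal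 O_D\subseteq\mathcal M_D$ be the Jacobian ideal, generated by the classes of $\partial h/\partial x_1,\dots,\partial h/\partial x_n$. A fractional ideal on $D$ is a finitely generated $\mathcal O_D$-submodule of $\mathcal M_D$ that contains a non-zero divisor, and the dual of a fractional ideal $\mathcal I$ is $\mathcal I^\vee=\{f\in\mathcal M_D\mid f\,\mathcal I\subseteq\mathcal O_D\}$. If $D$ is free, that is, if $\mathrm{Der}(-\log D)$ is a free $\mathcal O_S$-module, then $\mathcal J_D$ and $\mathcal R_D$ are fractional ideals and $\mathcal J_D=\mathcal R_D^\vee$ as submodules of $\mathcal M_D$. -/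

import Mathlib

open scoped nonZeroDivisors

namespace LogResidue

noncomputable section

/-! ### Convergent power series: the ring of germs of holomorphic functions at the origin -/

/-- A formal power series `∑ a_m x^m` in `n` variables is convergent if it converges absolutely at
`(r, …, r)` (hence on the closed polydisc of radius `r`) for some `r > 0`. -/
def IsConvergent {n : ℕ} (f : MvPowerSeries (Fin n) ℂ) : Prop :=
  ∃ r : ℝ, 0 < r ∧ Summable fun m : Fin n →₀ ℕ => ‖MvPowerSeries.coeff m f‖ * r ^ m.degree

theorem IsConvergent.mono {n : ℕ} {f : MvPowerSeries (Fin n) ℂ} {r s : ℝ} (hs : 0 ≤ s)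
    (hsr : s ≤ r)
    (hf : Summable fun m : Fin n →₀ ℕ => ‖MvPowerSeries.coeff m f‖ * r ^ m.degree) :
    Summable fun m : Fin n →₀ ℕ => ‖MvPowerSeries.coeff m f‖ * s ^ m.degree :=
  Summable.of_nonneg_of_le (fun m => by positivity)
    (fun m => by gcongr) hf

theorem IsConvergent.add {n : ℕ} {f g : MvPowerSeries (Fin n) ℂ}
    (hf : IsConvergent f) (hg : IsConvergent g) : IsConvergent (f + g) := by
  obtain ⟨r, hr, hf⟩ := hf
  obtain ⟨s, hs, hg⟩ := hg
  have ht : 0 < min r s := lt_min hr hs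
  refine ⟨min r s, ht, Summable.of_nonneg_of_le (fun m => by positivity) (fun m => ?_)
    ((IsConvergent.mono ht.le (min_le_left r s) hf).add
      (IsConvergent.mono ht.le (min_le_right r s) hg))⟩
  rw [map_add, ← add_mul]
  gcongr
  exact norm_add_le _ _

theorem IsConvergent.mul {n : ℕ} {f g : MvPowerSeries (Fin n) ℂ}
    (hf : IsConvergent f) (hg : IsConvergent g) : IsConvergent (f * g) := by
  obtain ⟨r, hr, hf⟩ := hf
  obtain ⟨s, hs, hg⟩ := hg
  have ht : 0 < min r s := lt_min hr hs
  set t := min r s with htdef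
  have hf' := IsConvergent.mono ht.le (min_le_left r s) hf
  have hg' := IsConvergent.mono ht.le (min_le_right r s) hg
  have hprod := summable_sum_mul_antidiagonal_of_summable_mul
    (Summable.mul_of_nonneg hf' hg' (fun m => by positivity) (fun m => by positivity))
  refine ⟨t, ht, Summable.of_nonneg_of_le (fun m => by positivity) (fun m => ?_) hprod⟩
  classical
  rw [MvPowerSeries.coeff_mul]
  calc ‖∑ p ∈ Finset.HasAntidiagonal.antidiagonal m, MvPowerSeries.coeff p.1 f * MvPowerSeries.coeff p.2 g‖
        * t ^ m.degree
      ≤ (∑ p ∈ Finset.HasAntidiagonal.antidiagonal m,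
          ‖MvPowerSeries.coeff p.1 f‖ * ‖MvPowerSeries.coeff p.2 g‖) * t ^ m.degree := by
        gcongr
        exact (norm_sum_le _ _).trans (Finset.sum_le_sum fun p _ => norm_mul_le _ _)
    _ = _ := by
        rw [Finset.sum_mul]
        refine Finset.sum_congr (by ext; simp) fun p hp => ?_
        rw [← Finset.HasAntidiagonal.mem_antidiagonal.mp hp, map_add, pow_add]
        ring

theorem IsConvergent.C {n : ℕ} (c : ℂ) : IsConvergent (MvPowerSeries.C (σ := Fin n) c) := by
  classical
  refine ⟨1, one_pos, summable_of_ne_finset_zero (s := {0}) fun m hm => ?_⟩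
  rw [MvPowerSeries.coeff_C, if_neg (by simpa using hm)]
  simp

theorem IsConvergent.pderiv {n : ℕ} {f : MvPowerSeries (Fin n) ℂ} (hf : IsConvergent f)
    (i : Fin n) : IsConvergent (MvPowerSeries.pderiv ℂ i f) := by
  obtain ⟨r, hr, hf⟩ := hf
  have hinj : Function.Injective fun m : Fin n →₀ ℕ => m + Finsupp.single i 1 :=
    add_left_injective _
  refine ⟨r / 2, by positivity, Summable.of_nonneg_of_le (fun m => by positivity) (fun m => ?_)
    ((hf.comp_injective hinj).mul_left r⁻¹)⟩
  have h1 : (m i : ℝ) + 1 ≤ 2 ^ m.degree := by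
    have : m i ≤ m.degree := Finsupp.le_degree i m
    have h2 : m.degree < 2 ^ m.degree := Nat.lt_two_pow_self
    exact_mod_cast (by omega : m i + 1 ≤ 2 ^ m.degree)
  have h3 : ‖(m i : ℂ) + 1‖ = (m i : ℝ) + 1 := by
    have : ((m i : ℂ) + 1) = ((m i + 1 : ℕ) : ℂ) := by push_cast; rfl
    rw [this, Complex.norm_natCast]
    push_cast
    rfl
  simp only [Function.comp_apply]
  rw [MvPowerSeries.coeff_pderiv, norm_mul, h3, map_add, Finsupp.degree_single, pow_succ]
  calc ‖MvPowerSeries.coeff (m + Finsupp.single i 1) f‖ * ((m i : ℝ) + 1) * (r / 2) ^ m.degree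
      ≤ ‖MvPowerSeries.coeff (m + Finsupp.single i 1) f‖ * 2 ^ m.degree
          * (r / 2) ^ m.degree := by gcongr
    _ = ‖MvPowerSeries.coeff (m + Finsupp.single i 1) f‖ * r ^ m.degree := by
        rw [mul_assoc, ← mul_pow]
        congr 2
        ring
    _ = _ := by field_simp

/-- `ℂ{x₁, …, xₙ}`, the local ring `𝒪_S` of the germ `S = (ℂⁿ, 0)`, as a subalgebra of the formal
power series. -/
def convergentPowerSeries (n : ℕ) : Subalgebra ℂ (MvPowerSeries (Fin n) ℂ) where
  carrier := {f | IsConvergent f}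
  mul_mem' hf hg := hf.mul hg
  add_mem' hf hg := hf.add hg
  algebraMap_mem' c := IsConvergent.C c

/-- `𝒪_S` for `S = (ℂⁿ, 0)`. -/
def OS (n : ℕ) : Type := convergentPowerSeries n

instance (n : ℕ) : CommRing (OS n) := inferInstanceAs (CommRing (convergentPowerSeries n))

instance (n : ℕ) : Algebra ℂ (OS n) := inferInstanceAs (Algebra ℂ (convergentPowerSeries n))

instance (n : ℕ) : IsDomain (OS n) := 
  haveI : IsDomain (MvPowerSeries (Fin n) ℂ) := NoZeroDivisors.to_isDomain _
  Function.Injective.isDomain (convergentPowerSeries n).val.toRingHom Subtype.val_injective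

/-- The partial derivative `∂/∂xᵢ` on `𝒪_S`. -/
def partialDeriv {n : ℕ} (i : Fin n) : Derivation ℂ (OS n) (OS n) where
  toFun f := ⟨MvPowerSeries.pderiv ℂ i f.1, IsConvergent.pderiv f.2 i⟩
  map_add' _ _ := Subtype.ext (map_add _ _ _)
  map_smul' c f := Subtype.ext ((MvPowerSeries.pderiv ℂ i).map_smul c f.1)
  map_one_eq_zero' := Subtype.ext (MvPowerSeries.pderiv ℂ i).map_one_eq_zero
  leibniz' f g := Subtype.ext ((MvPowerSeries.pderiv ℂ i).leibniz f.1 g.1)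

/-! ### Meromorphic functions on `S` and their partial derivatives -/

/-- The field of meromorphic functions on `S`. -/
abbrev MS (n : ℕ) : Type := FractionRing (OS n)

section

variable {A : Type} [CommRing A] [Algebra ℂ A]

/-- The ring homomorphism `a / b ↦ a / b + ε (a / b)'` into the dual numbers. -/
def fracDualNumber (d : Derivation ℂ A A) :
    FractionRing A →+* TrivSqZeroExt (FractionRing A) (FractionRing A) :=
  IsLocalization.lift (M := A⁰) (S := FractionRing A)
    (g :=
      { toFun := fun a => TrivSqZeroExt.inl (algebraMap A (FractionRing A) a) +
          TrivSqZeroExt.inr (algebraMap A (FractionRing A) (d a))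
        map_one' := by ext <;> simp
        map_mul' := fun a b => by ext <;> simp [mul_comm, -smul_algebraMap, -algebraMap_smul]
        map_zero' := by ext <;> simp
        map_add' := fun a b => by ext <;> simp [Algebra.algebraMap_eq_smul_one, add_smul] })
    (fun b => TrivSqZeroExt.isUnit_iff_isUnit_fst.mpr (by
      simpa using IsLocalization.map_units (FractionRing A) b))

theorem fst_fracDualNumber (d : Derivation ℂ A A) (x : FractionRing A) :
    (fracDualNumber d x).fst = x := by
  have : ((TrivSqZeroExt.fstHom (FractionRing A) (FractionRing A) (FractionRing A) :
      _ →+* FractionRing A).comp (fracDualNumber d)) = RingHom.id (FractionRing A) := by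
    refine IsLocalization.ringHom_ext A⁰ (RingHom.ext fun a => ?_)
    simp only [fracDualNumber, RingHom.comp_apply, IsLocalization.lift_eq]
    simp
  exact congrArg (fun f => f x) this

/-- The unique extension of a derivation of `A` to its total ring of fractions (the quotient
rule). -/
def fracDeriv (d : Derivation ℂ A A) (x : FractionRing A) : FractionRing A :=
  (fracDualNumber d x).snd

theorem fracDeriv_algebraMap (d : Derivation ℂ A A) (a : A) :
    fracDeriv d (algebraMap A (FractionRing A) a) = algebraMap A (FractionRing A) (d a) := by
  simp only [fracDeriv, fracDualNumber, IsLocalization.lift_eq]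
  simp [Algebra.algebraMap_eq_smul_one]

theorem fracDeriv_add (d : Derivation ℂ A A) (x y : FractionRing A) :
    fracDeriv d (x + y) = fracDeriv d x + fracDeriv d y := by
  simp [fracDeriv]

theorem fracDeriv_zero (d : Derivation ℂ A A) : fracDeriv d (0 : FractionRing A) = 0 := by
  simp [fracDeriv]

theorem fracDeriv_mul (d : Derivation ℂ A A) (x y : FractionRing A) :
    fracDeriv d (x * y) = x * fracDeriv d y + y * fracDeriv d x := by
  simp [fracDeriv, fst_fracDualNumber, mul_comm]

end

/-! ### The divisor `D = {h = 0}`, logarithmic vector fields and logarithmic forms -/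

/-- `𝒪_D = 𝒪_S / 𝒪_S h`. -/
abbrev OD {n : ℕ} (h : OS n) : Type := OS n ⧸ Ideal.span {h}

/-- The ring `ℳ_D` of meromorphic functions on `D`: the total ring of fractions of `𝒪_D`. -/
abbrev MD {n : ℕ} (h : OS n) : Type := FractionRing (OD h)

/-- `Der(-log D)`: the vector fields `δ ∈ Θ_S = Der_ℂ(𝒪_S)` with `dh(δ) = δ(h) ∈ 𝒪_S h`. -/
def logDer {n : ℕ} (h : OS n) : Submodule (OS n) (Derivation ℂ (OS n) (OS n)) where
  carrier := {δ | δ h ∈ Ideal.span {h}}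
  zero_mem' := by simp
  add_mem' hδ hε := by simpa using Ideal.add_mem _ hδ hε
  smul_mem' f δ hδ := by simpa using Ideal.mul_mem_left _ f hδ

/-- `D` is free if `Der(-log D)` is a free `𝒪_S`-module. -/
def IsFreeDivisor {n : ℕ} (h : OS n) : Prop := Module.Free (OS n) (logDer h)

/-- A meromorphic `1`-form `∑ ωᵢ dxᵢ` on `S`, given by its coefficients. -/
abbrev MeroOneForm (n : ℕ) : Type := Fin n → MS n

/-- A meromorphic `2`-form `∑_{i < j} ωᵢⱼ dxᵢ ∧ dxⱼ` on `S`, given by its coefficients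
(alternating in `i, j`). -/
abbrev MeroTwoForm (n : ℕ) : Type := Fin n → Fin n → MS n

/-- The exterior derivative of a `1`-form: `(dω)ᵢⱼ = ∂ᵢωⱼ - ∂ⱼωᵢ`. -/
def dOneForm {n : ℕ} (ω : MeroOneForm n) : MeroTwoForm n := fun i j =>
  fracDeriv (partialDeriv i) (ω j) - fracDeriv (partialDeriv j) (ω i)

/-- `𝒪_S(D) = h⁻¹ 𝒪_S`: the meromorphic functions `a` on `S` such that `h a` is holomorphic. -/
def simplePole {n : ℕ} (h : OS n) : Submodule (OS n) (MS n) where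
  carrier := {a | ∃ b : OS n, algebraMap (OS n) (MS n) h * a = algebraMap (OS n) (MS n) b}
  zero_mem' := ⟨0, by simp⟩
  add_mem' := by
    rintro a a' ⟨b, hb⟩ ⟨b', hb'⟩
    exact ⟨b + b', by rw [mul_add, hb, hb', map_add]⟩
  smul_mem' := by
    rintro f a ⟨b, hb⟩
    exact ⟨f * b, by rw [Algebra.smul_def, map_mul, ← hb]; ring⟩

/-- `Ω¹(log D)`: the meromorphic `1`-forms `ω ∈ Ω¹_S(D)` with `dω ∈ Ω²_S(D)`. -/
def logForms {n : ℕ} (h : OS n) : Submodule (OS n) (MeroOneForm n) where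
  carrier := {ω | (∀ i, ω i ∈ simplePole h) ∧ ∀ i j, dOneForm ω i j ∈ simplePole h}
  zero_mem' := by
    refine ⟨fun i => Submodule.zero_mem _, fun i j => ?_⟩
    simp only [dOneForm, Pi.zero_apply, fracDeriv_zero, sub_zero]
    exact Submodule.zero_mem _
  add_mem' := by
    rintro ω ω' ⟨h1, h2⟩ ⟨h1', h2'⟩
    refine ⟨fun i => Submodule.add_mem _ (h1 i) (h1' i), fun i j => ?_⟩
    have : dOneForm (ω + ω') i j = dOneForm ω i j + dOneForm ω' i j := by
      simp only [dOneForm, Pi.add_apply, fracDeriv_add]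
      ring
    rw [this]
    exact Submodule.add_mem _ (h2 i j) (h2' i j)
  smul_mem' := by
    rintro f ω ⟨h1, h2⟩
    refine ⟨fun i => Submodule.smul_mem _ f (h1 i), fun i j => ?_⟩
    have : dOneForm (f • ω) i j =
        f • dOneForm ω i j + (partialDeriv i f • ω j - partialDeriv j f • ω i) := by
      simp only [dOneForm, Pi.smul_apply, Algebra.smul_def, fracDeriv_mul, fracDeriv_algebraMap]
      ring
    rw [this]
    exact Submodule.add_mem _ (Submodule.smul_mem _ _ (h2 i j))
      (Submodule.sub_mem _ (Submodule.smul_mem _ _ (h1 j)) (Submodule.smul_mem _ _ (h1 i)))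

/-! ### Residues -/

/-- `r ∈ ℳ_D` is the residue `ρ_D(ω)` of the `1`-form `ω`: there are `ξ, g ∈ 𝒪_S` and
`η ∈ Ω¹_S` such that `g` restricts to a non-zero divisor of `𝒪_D`,
`ω = (dh / h) (ξ / g) + η / g`, and `r = (ξ / g)|_D`. The equation for `ω` is multiplied by `g`. -/
def IsResidue {n : ℕ} (h : OS n) (ω : MeroOneForm n) (r : MD h) : Prop :=
  ∃ (ξ g : OS n) (η : Fin n → OS n) (hg : Ideal.Quotient.mk (Ideal.span {h}) g ∈ (OD h)⁰),
    (∀ i, algebraMap (OS n) (MS n) g * ω i =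
      algebraMap (OS n) (MS n) ξ *
          (algebraMap (OS n) (MS n) (partialDeriv i h) / algebraMap (OS n) (MS n) h) +
        algebraMap (OS n) (MS n) (η i)) ∧
    r = IsLocalization.mk' (MD h) (Ideal.Quotient.mk (Ideal.span {h}) ξ) (⟨_, hg⟩ : (OD h)⁰)

/-- `ℛ_D = ρ_D(Ω¹(log D)) ⊆ ℳ_D`, the module of residues of logarithmic `1`-forms. -/
def residueModule {n : ℕ} (h : OS n) : Submodule (OD h) (MD h) where
  carrier := {r | ∃ ω ∈ logForms h, IsResidue h ω r}
  zero_mem' := by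
    refine ⟨0, Submodule.zero_mem _, 0, 1, 0, ?_, by simp, ?_⟩
    · rw [map_one]; exact Submonoid.one_mem _
    · rw [map_zero, IsLocalization.mk'_zero]
  add_mem' := by
    rintro r r' ⟨ω, hω, ξ, g, η, hg, hdec, rfl⟩ ⟨ω', hω', ξ', g', η', hg', hdec', rfl⟩
    refine ⟨ω + ω', Submodule.add_mem _ hω hω', ξ * g' + ξ' * g, g * g',
      fun i => g' * η i + g * η' i, ?_, fun i => ?_, ?_⟩
    · rw [map_mul]; exact Submonoid.mul_mem _ hg hg'
    · simp only [Pi.add_apply, map_add, map_mul]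
      linear_combination (algebraMap (OS n) (MS n) g') * hdec i +
        (algebraMap (OS n) (MS n) g) * hdec' i
    · rw [← IsLocalization.mk'_add]
      congr 1
  smul_mem' := by
    rintro c r ⟨ω, hω, ξ, g, η, hg, hdec, rfl⟩
    obtain ⟨f, rfl⟩ := Ideal.Quotient.mk_surjective c
    refine ⟨f • ω, Submodule.smul_mem _ f hω, f * ξ, g, fun i => f * η i, hg, fun i => ?_, ?_⟩
    · simp only [Pi.smul_apply, Algebra.smul_def, map_mul]
      linear_combination (algebraMap (OS n) (MS n) f) * hdec i
    · rw [IsLocalization.smul_mk', map_mul]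

/-! ### Fractional ideals on `D` -/

/-- The Jacobian ideal `𝒥_D ⊆ 𝒪_D`, generated by the classes of the `∂h/∂xᵢ`. -/
def jacobianIdeal {n : ℕ} (h : OS n) : Ideal (OD h) :=
  Ideal.span (Set.range fun i : Fin n => Ideal.Quotient.mk (Ideal.span {h}) (partialDeriv i h))

/-- The Jacobian ideal as an `𝒪_D`-submodule of `ℳ_D`. -/
def jacobianModule {n : ℕ} (h : OS n) : Submodule (OD h) (MD h) :=
  IsLocalization.coeSubmodule (MD h) (jacobianIdeal h)

/-- A fractional ideal on `D`: a finite `𝒪_D`-submodule of `ℳ_D` that contains a non-zero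
divisor. -/
def IsFractionalIdealOn {n : ℕ} (h : OS n) (I : Submodule (OD h) (MD h)) : Prop :=
  I.FG ∧ ∃ x ∈ I, x ∈ (MD h)⁰

/-- The dual `I^∨ = {f ∈ ℳ_D | f I ⊆ 𝒪_D}`. -/
def dual {n : ℕ} (h : OS n) (I : Submodule (OD h) (MD h)) : Submodule (OD h) (MD h) where
  carrier := {f | ∀ x ∈ I, ∃ a : OD h, f * x = algebraMap (OD h) (MD h) a}
  zero_mem' x _ := ⟨0, by simp⟩
  add_mem' := by
    intro f f' hf hf' x hx
    obtain ⟨a, ha⟩ := hf x hx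
    obtain ⟨a', ha'⟩ := hf' x hx
    exact ⟨a + a', by rw [add_mul, ha, ha', map_add]⟩
  smul_mem' := by
    intro c f hf x hx
    obtain ⟨a, ha⟩ := hf x hx
    exact ⟨c * a, by rw [smul_mul_assoc, ha, Algebra.smul_def, map_mul]⟩

end

end LogResidue

/-! Freeness turns into a matrix factorization of `h`. A vector field is the vector of its
coefficients, so `Der(-log D)` is the module of relations `c` with `∑ cⱼ ∂ⱼh ∈ (h)` (`logDerEquiv`).
Put a basis into the columns of a matrix `M`. The relations `h eⱼ` give `N` with `MN = h`, and
injectivity of `M` gives `NM = h` (`exists_matrix_factorization`). Modulo `h`, the `k`-th row of `N`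
is a multiple `r_k` of the gradient of `h`, with `r_k ∈ ℳ_D`. Multiplying by one factor and
cancelling `h` shows that the `r_k` generate `𝒥^∨` and that `𝒥^∨∨ = 𝒥` (`exists_dual_generators`).

On the side of forms, `ℛ_D = 𝒥^∨` as soon as `𝒥` contains a non-zero divisor
(`mem_residueModule_iff`). An `r` in `𝒥^∨` corresponds to `ω = ∑ aⱼ dxⱼ / h` with `aⱼ = r ∂ⱼh` on
`D`; then `aⱼ ∂ᵢh = aᵢ ∂ⱼh` on `D`, which is what makes `h dω` holomorphic.

Reducedness supplies the non-zero divisor (`exists_directional_derivative`). After a linear change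
of coordinates `h` is regular in some `x_e`, and Weierstrass division identifies `𝒪_D` with
`B[T]/(W)`, where `W` is monic over the ring `B` of germs free of `x_e`. As `𝒪_D` is reduced, `W` is
squarefree over `Frac B`, hence coprime to `W'` in characteristic zero, so `∂h/∂x_e` is a non-zero
divisor on `D`. The division theorem comes from a contraction in weighted `ℓ¹` norms. -/

namespace LogResidue

/-! ### Matrix factorizations and double duals -/

section MatrixFactorization

variable {A σ : Type*} [CommRing A] [Fintype σ]

/-- The vectors `c` with `∑ cⱼ gⱼ ∈ (h)`. -/
def relations (h : A) (g : σ → A) : Submodule A (σ → A) where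
  carrier := {c | h ∣ ∑ j, c j * g j}
  zero_mem' := by simp
  add_mem' := by
    intro c c' hc hc'
    simpa [add_mul, Finset.sum_add_distrib] using dvd_add hc hc'
  smul_mem' := by
    intro a c hc
    simpa [mul_assoc, ← Finset.mul_sum] using Dvd.dvd.mul_left hc a

theorem mem_relations {h : A} {g : σ → A} {c : σ → A} :
    c ∈ relations h g ↔ h ∣ ∑ j, c j * g j := Iff.rfl

open Matrix in
/-- A free module of relations modulo `h` gives a matrix factorization of `h`. -/
theorem exists_matrix_factorization [IsDomain A] [DecidableEq σ] (h : A) (g : σ → A)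
    (hfree : Module.Free A (relations h g)) :
    ∃ (ι : Type) (_ : Fintype ι) (_ : DecidableEq ι) (M : Matrix σ ι A) (N : Matrix ι σ A),
      M * N = h • (1 : Matrix σ σ A) ∧ N * M = h • (1 : Matrix ι ι A) ∧
      (∀ k, h ∣ ∑ j, M j k * g j) ∧
      ∀ c : σ → A, h ∣ ∑ j, c j * g j → ∃ w, c = M *ᵥ w := by
  classical
  let b₀ := Module.Free.chooseBasis A (relations h g)
  have hli : LinearIndependent A fun k => (b₀ k : σ → A) :=
    b₀.linearIndependent.map' (relations h g).subtype (Submodule.ker_subtype _)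
  -- An independent family in the finitely generated module `A^σ` is finite, so no Noetherian
  -- hypothesis is needed.
  have hfin : Finite (Module.Free.ChooseBasisIndex A (relations h g)) :=
    Set.finite_univ_iff.mp (Set.finite_univ_iff.mpr
      (LinearIndependent.finite_of_le_span_finite _ hli
        (Set.range (Pi.basisFun A σ)) (by rw [(Pi.basisFun A σ).span_eq]; simp)))
  obtain ⟨m, ⟨e⟩⟩ := Finite.exists_equiv_fin (Module.Free.ChooseBasisIndex A (relations h g))
  let b := b₀.reindex e
  let M : Matrix σ (Fin m) A := Matrix.of fun j k => (b k : σ → A) j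
  have hMw (w : Fin m → A) : M *ᵥ w = ((∑ k, w k • b k : relations h g) : σ → A) := by
    ext j
    simp [M, Matrix.mulVec, dotProduct, Finset.sum_apply, mul_comm]
  have hsurj (c : σ → A) (hc : h ∣ ∑ j, c j * g j) : ∃ w, c = M *ᵥ w := by
    refine ⟨b.repr ⟨c, hc⟩, ?_⟩
    rw [hMw, b.sum_repr]
  have hinj (w : Fin m → A) (hw : M *ᵥ w = 0) : w = 0 := by
    rw [hMw] at hw
    have := Fintype.linearIndependent_iff.mp b.linearIndependent w (Subtype.ext hw)
    exact funext this
  -- `h eⱼ` is a relation; its coordinates in the basis form the `j`-th column of `N`.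
  have hrel (j : σ) : ∃ w, h • (Pi.single j 1 : σ → A) = M *ᵥ w := by
    refine hsurj _ (Dvd.intro (g j) ?_)
    simp [Pi.single_apply]
  choose w hw using hrel
  let N : Matrix (Fin m) σ A := Matrix.of fun k j => w j k
  have hMN : M * N = h • (1 : Matrix σ σ A) := by
    ext i j
    have := congrFun (hw j) i
    simp only [Matrix.mul_apply, N, Matrix.of_apply]
    simp only [Matrix.mulVec, dotProduct] at this
    rw [← this]
    simp [Matrix.one_apply, Pi.single_apply]
  refine ⟨Fin m, inferInstance, inferInstance, M, N, hMN, ?_, fun k => (b k).2, hsurj⟩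
  ext i k
  -- `M(NM - h) = (MN)M - hM = 0`, and `M` is injective.
  have key : M *ᵥ ((N * M - h • (1 : Matrix (Fin m) (Fin m) A)) *ᵥ Pi.single k 1) = 0 := by
    rw [Matrix.mulVec_mulVec, Matrix.mul_sub, ← Matrix.mul_assoc, hMN]
    simp
    rfl
  have := congrFun (hinj _ key) i
  simpa [sub_eq_zero] using this

open Matrix in
/-- If the relations of `g` modulo `h` form a free module, the dual of the ideal generated by `g`
modulo `h` is finitely generated, and the ideal is its own double dual. -/
theorem exists_dual_generators [IsDomain A] [DecidableEq σ] {Q : Type*} [CommRing Q] (q : A →+* Q)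
    {h : A} (hh : h ≠ 0) (hq : ∀ a, q a = 0 ↔ h ∣ a) (g v : σ → A)
    (hu : IsUnit (q (∑ j, v j * g j))) (hfree : Module.Free A (relations h g)) :
    ∃ (ι : Type) (_ : Fintype ι) (r : ι → Q), (∀ k j, ∃ a, r k * q (g j) = q a) ∧
      (∀ s : Q, (∀ j, ∃ a, s * q (g j) = q a) → ∃ w : ι → A, s = ∑ k, q (w k) * r k) ∧
      ∀ f : Q, (∀ k, ∃ b, f * r k = q b) → ∃ c : σ → A, f = ∑ j, q (c j) * q (g j) := by
  obtain ⟨ι, _, _, M, N, hMN, hNM, hM, hsurj⟩ := exists_matrix_factorization h g hfree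
  obtain ⟨u, hu⟩ := hu
  have hfaith (s : Q) (hs : ∀ j, s * q (g j) = 0) : s = 0 := by
    rw [← u.mul_left_eq_zero, hu, map_sum, Finset.mul_sum]
    refine Finset.sum_eq_zero fun j _ => ?_
    rw [map_mul, mul_left_comm, hs, mul_zero]
  -- The Koszul relation `gⱼ eᵢ - gᵢ eⱼ` equals `M w`, so `N` maps it to `h w`: modulo `h` the rows
  -- of `N` are proportional to `g`.
  have hminor (k : ι) (i j : σ) : q (N k i) * q (g j) = q (N k j) * q (g i) := by
    rw [← sub_eq_zero, ← map_mul, ← map_mul, ← map_sub, hq]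
    obtain ⟨w, hw⟩ := hsurj (Pi.single i (g j) - Pi.single j (g i)) (by
      simp [Pi.single_apply, sub_mul, Finset.sum_sub_distrib, mul_comm (g j)])
    have h1 := congrArg (fun x => (N *ᵥ x) k) hw
    simp only [Matrix.mulVec_mulVec, hNM, Matrix.mulVec_sub, Matrix.smul_mulVec,
      Matrix.one_mulVec, Pi.sub_apply, Pi.smul_apply, smul_eq_mul,
      Matrix.mulVec_single, Matrix.col_apply, MulOpposite.smul_eq_mul_unop,
      MulOpposite.unop_op] at h1
    exact ⟨w k, h1⟩
  -- The factor of proportionality, found by pairing both sides with `v`.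
  let r : ι → Q := fun k => ↑u⁻¹ * ∑ j, q (v j) * q (N k j)
  have hr (k : ι) (j : σ) : r k * q (g j) = q (N k j) := by
    simp only [r]
    rw [mul_assoc, Units.inv_mul_eq_iff_eq_mul, hu, Finset.sum_mul, map_sum, Finset.sum_mul]
    refine Finset.sum_congr rfl fun i _ => ?_
    rw [map_mul, mul_assoc, hminor, mul_assoc, mul_comm (q (N k j))]
  -- If `s g = a` modulo `h`, then `a` kills the columns of `M` modulo `h`, say `aM = h w`.
  -- Multiplying by `N` and cancelling `h` gives `a = wN`, that is, `s g = ∑ w_k r_k g`.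
  have hgen (s : Q) (hs : ∀ j, ∃ a, s * q (g j) = q a) :
      ∃ w : ι → A, s = ∑ k, q (w k) * r k := by
    choose a ha using hs
    have h1 (k : ι) : h ∣ ∑ j, a j * M j k := by
      rw [← hq, map_sum]
      have := (hq _).mpr (hM k)
      rw [map_sum] at this
      calc ∑ j, q (a j * M j k) = s * ∑ j, q (M j k * g j) := by
            rw [Finset.mul_sum]
            refine Finset.sum_congr rfl fun j _ => ?_
            rw [map_mul, map_mul, ← ha]; ring
        _ = 0 := by rw [this, mul_zero]
    choose w hw using h1
    have h2 : a ᵥ* M = h • w := by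
      ext k; simpa [Matrix.vecMul, dotProduct] using hw k
    have h3 : a = w ᵥ* N := by
      have := congrArg (· ᵥ* N) h2
      simp only [Matrix.vecMul_vecMul, hMN, Matrix.vecMul_smul, Matrix.vecMul_one,
        Matrix.smul_vecMul] at this
      exact smul_right_injective _ hh this
    refine ⟨w, sub_eq_zero.mp (hfaith _ fun j => ?_)⟩
    rw [sub_mul, ha, h3, Finset.sum_mul, sub_eq_zero]
    simp only [mul_assoc, hr, Matrix.vecMul, dotProduct, map_sum, map_mul]
  refine ⟨ι, inferInstance, r, fun k j => ⟨_, hr k j⟩, hgen, fun f hf => ?_⟩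
  choose b hb using hf
  -- `MN = h` forces `∑ M_{ik} r_k = 0` in `Q`. Hence `Mb = h c`, and applying `N` yields `b = Nc`.
  have h1 (i : σ) : h ∣ ∑ k, M i k * b k := by
    rw [← hq, map_sum]
    calc ∑ k, q (M i k * b k) = f * ∑ k, q (M i k) * r k := by
          rw [Finset.mul_sum]
          refine Finset.sum_congr rfl fun k _ => ?_
          rw [map_mul, ← hb]; ring
      _ = 0 := by
          rw [hfaith (∑ k, q (M i k) * r k), mul_zero]
          intro j
          have h2 := congrArg q (congrFun (congrFun hMN i) j)
          simp only [Matrix.mul_apply, map_sum, map_mul, Matrix.smul_apply, smul_eq_mul,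
            (hq h).mpr dvd_rfl, zero_mul] at h2
          rw [Finset.sum_mul, ← h2]
          exact Finset.sum_congr rfl fun k _ => by rw [mul_assoc, hr]
  choose c hc using h1
  have h2 : M *ᵥ b = h • c := by
    ext i; simpa [Matrix.mulVec, dotProduct] using hc i
  have h3 : b = N *ᵥ c := by
    have := congrArg (N *ᵥ ·) h2
    simp only [Matrix.mulVec_mulVec, hNM, Matrix.mulVec_smul, Matrix.one_mulVec,
      Matrix.smul_mulVec] at this
    exact smul_right_injective _ hh this
  refine ⟨c, ?_⟩
  -- `f` and `∑ cⱼ gⱼ` agree after multiplication by each `r_k`; since `1` is a combination of the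
  -- `r_k`, they are equal.
  obtain ⟨w, hw⟩ := hgen 1 fun j => ⟨g j, one_mul _⟩
  rw [← sub_eq_zero, ← mul_one (f - _), hw, Finset.mul_sum]
  refine Finset.sum_eq_zero fun k _ => ?_
  rw [mul_left_comm, sub_mul, hb, h3, Finset.sum_mul]
  simp only [Matrix.mulVec, dotProduct, map_sum, map_mul, mul_assoc, mul_comm (q (g _)), hr,
    mul_comm (q (N _ _)), sub_self, mul_zero]

end MatrixFactorization

/-! ### Residues as the dual of the Jacobian ideal -/

section Residues

variable {n : ℕ} {h : OS n}

/-- Restriction of holomorphic functions to `D`, with values in `ℳ_D`. -/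
noncomputable def restrict (h : OS n) : OS n →+* MD h :=
  (algebraMap (OD h) (MD h)).comp (Ideal.Quotient.mk (Ideal.span {h}))

theorem restrict_eq_zero_iff (a : OS n) : restrict h a = 0 ↔ h ∣ a := by
  rw [restrict, RingHom.comp_apply,
    map_eq_zero_iff _ (IsFractionRing.injective (OD h) (MD h)), Ideal.Quotient.eq_zero_iff_dvd]

theorem restrict_eq_restrict_iff (a b : OS n) : restrict h a = restrict h b ↔ h ∣ a - b := by
  rw [← sub_eq_zero, ← map_sub, restrict_eq_zero_iff]

theorem exists_algebraMap_eq_iff (x : MD h) :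
    (∃ a : OD h, x = algebraMap (OD h) (MD h) a) ↔ ∃ a : OS n, x = restrict h a :=
  ⟨fun ⟨a, ha⟩ => by
    obtain ⟨b, rfl⟩ := Ideal.Quotient.mk_surjective a
    exact ⟨b, ha⟩, fun ⟨a, ha⟩ => ⟨_, ha⟩⟩

theorem jacobianModule_eq_span : jacobianModule h =
    Submodule.span (OD h) (Set.range fun i : Fin n => restrict h (partialDeriv i h)) := by
  rw [jacobianModule, jacobianIdeal, IsLocalization.coeSubmodule_span, ← Set.range_comp]
  rfl

theorem mem_dual_span_iff {ι : Type*} (x : ι → MD h) (f : MD h) :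
    f ∈ dual h (Submodule.span (OD h) (Set.range x)) ↔ ∀ i, ∃ a, f * x i = restrict h a := by
  constructor
  · intro hf i
    exact (exists_algebraMap_eq_iff _).mp (hf _ (Submodule.subset_span ⟨i, rfl⟩))
  · intro hf y hy
    induction hy using Submodule.span_induction with
    | mem y hy =>
      obtain ⟨i, rfl⟩ := hy
      exact (exists_algebraMap_eq_iff _).mpr (hf i)
    | zero => exact ⟨0, by simp⟩
    | add y z _ _ hy hz =>
      obtain ⟨a, ha⟩ := hy
      obtain ⟨b, hb⟩ := hz
      exact ⟨a + b, by rw [mul_add, ha, hb, map_add]⟩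
    | smul c y _ hy =>
      obtain ⟨a, ha⟩ := hy
      exact ⟨c * a, by rw [mul_smul_comm, ha, Algebra.smul_def, map_mul]⟩

theorem mem_span_of_eq_sum {ι : Type*} [Fintype ι] (x : ι → MD h) (c : ι → OS n) :
    ∑ i, restrict h (c i) * x i ∈ Submodule.span (OD h) (Set.range x) := by
  refine Submodule.sum_mem _ fun i _ => ?_
  rw [restrict, RingHom.comp_apply, ← Algebra.smul_def]
  exact Submodule.smul_mem _ _ (Submodule.subset_span ⟨i, rfl⟩)

theorem isUnit_restrict_iff (g : OS n) :
    IsUnit (restrict h g) ↔ Ideal.Quotient.mk (Ideal.span {h}) g ∈ (OD h)⁰ := by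
  constructor
  · intro hu
    refine mem_nonZeroDivisors_iff_right.mpr fun x hx => ?_
    rw [← map_eq_zero_iff _ (IsFractionRing.injective (OD h) (MD h)), ← hu.mul_left_eq_zero,
      restrict, RingHom.comp_apply, ← map_mul, hx, map_zero]
  · intro hg
    exact IsLocalization.map_units (MD h) ⟨_, hg⟩

/-- The residues of logarithmic `1`-forms form the dual of the Jacobian ideal, provided that the
latter contains a non-zero divisor. -/
theorem mem_residueModule_iff (hh : h ≠ 0) (v : Fin n → OS n)
    (hv : IsUnit (restrict h (∑ j, v j * partialDeriv j h))) (r : MD h) :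
    r ∈ residueModule h ↔ ∀ j, ∃ a, r * restrict h (partialDeriv j h) = restrict h a := by
  have hinj : Function.Injective (algebraMap (OS n) (MS n)) := IsFractionRing.injective _ _
  have hh' : algebraMap (OS n) (MS n) h ≠ 0 := by
    rwa [Ne, map_eq_zero_iff _ hinj]
  constructor
  · rintro ⟨ω, hω, ξ, g, η, hg, hdec, rfl⟩ j
    obtain ⟨a, ha⟩ := hω.1 j
    refine ⟨a, ?_⟩
    have hu : IsUnit (restrict h g) := (isUnit_restrict_iff g).mpr hg
    -- The decomposition of `g ω`, multiplied by `h`; restricted to `D` it says `(ξ/g) ∂ⱼh = a`.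
    have h1 : g * a - ξ * partialDeriv j h = h * η j := by
      apply hinj
      have := hdec j
      field_simp at this
      simp only [map_mul, map_sub, ← ha]
      linear_combination this
    have h2 : restrict h g * restrict h a = restrict h ξ * restrict h (partialDeriv j h) := by
      rw [← map_mul, ← map_mul, restrict_eq_restrict_iff, h1]
      exact dvd_mul_right _ _
    have h3 : IsLocalization.mk' (MD h) (Ideal.Quotient.mk (Ideal.span {h}) ξ)
        (⟨_, hg⟩ : (OD h)⁰) * restrict h g = restrict h ξ :=
      IsLocalization.mk'_spec (MD h) (Ideal.Quotient.mk (Ideal.span {h}) ξ) (⟨_, hg⟩ : (OD h)⁰)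
    refine hu.mul_left_cancel ?_
    rw [h2, ← h3]
    ring
  · intro hr
    choose a ha using hr
    -- Both products restrict to `r ∂ᵢh ∂ⱼh`. This symmetry will give `dω` a simple pole.
    have hsymm (i j : Fin n) : h ∣ a j * partialDeriv i h - a i * partialDeriv j h := by
      rw [← restrict_eq_restrict_iff, map_mul, map_mul, ← ha, ← ha]
      ring
    -- Contraction of `dh` and of `h ω` with the vector field `v`; on `D` one gets `ξ = r g`.
    set g := ∑ j, v j * partialDeriv j h with hgdef
    set ξ := ∑ j, v j * a j with hξdef
    have hg := (isUnit_restrict_iff _).mp hv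
    have hξ : r * restrict h g = restrict h ξ := by
      simp only [hgdef, hξdef, map_sum, Finset.mul_sum, map_mul, ← ha]
      exact Finset.sum_congr rfl fun j _ => by ring
    have hη (j : Fin n) : h ∣ g * a j - ξ * partialDeriv j h := by
      rw [← restrict_eq_restrict_iff, map_mul, map_mul, ← ha, ← hξ]
      ring
    choose η hη using hη
    have hω (j : Fin n) : algebraMap (OS n) (MS n) h *
        (algebraMap (OS n) (MS n) (a j) / algebraMap (OS n) (MS n) h) =
          algebraMap (OS n) (MS n) (a j) := by field_simp
    refine ⟨fun j => algebraMap (OS n) (MS n) (a j) / algebraMap (OS n) (MS n) h,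
      ⟨fun j => ⟨a j, hω j⟩, fun i j => ?_⟩, ξ, g, η, hg, fun j => ?_, ?_⟩
    · obtain ⟨c, hc⟩ := hsymm i j
      -- By the quotient rule the `(i, j)` coefficient of `h dω` is `∂ᵢaⱼ - ∂ⱼaᵢ - (aⱼ ∂ᵢh - aᵢ
      -- ∂ⱼh)/h`, and `c` is the last quotient.
      refine ⟨partialDeriv i (a j) - partialDeriv j (a i) - c, ?_⟩
      have h1 := congrArg (fracDeriv (partialDeriv i)) (hω j)
      have h2 := congrArg (fracDeriv (partialDeriv j)) (hω i)
      rw [fracDeriv_mul, fracDeriv_algebraMap, fracDeriv_algebraMap] at h1 h2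
      have h3 := congrArg (algebraMap (OS n) (MS n)) hc
      simp only [map_sub, map_mul] at h3
      have h4 : algebraMap (OS n) (MS n) c =
          (algebraMap (OS n) (MS n) (a j) / algebraMap (OS n) (MS n) h) *
            algebraMap (OS n) (MS n) (partialDeriv i h) -
          (algebraMap (OS n) (MS n) (a i) / algebraMap (OS n) (MS n) h) *
            algebraMap (OS n) (MS n) (partialDeriv j h) := by
        field_simp
        linear_combination -h3
      simp only [dOneForm, map_sub, h4]
      linear_combination h1 - h2
    · have := congrArg (algebraMap (OS n) (MS n)) (hη j)
      simp only [map_sub, map_mul] at this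
      field_simp
      linear_combination this
    · rw [eq_comm, IsLocalization.mk'_eq_iff_eq_mul]
      exact hξ.symm

theorem residueModule_eq_dual (hh : h ≠ 0) (v : Fin n → OS n)
    (hv : IsUnit (restrict h (∑ j, v j * partialDeriv j h))) :
    residueModule h = dual h (jacobianModule h) := by
  ext r
  rw [mem_residueModule_iff hh v hv, jacobianModule_eq_span, mem_dual_span_iff]

/-- The conclusion for a divisor whose relations form a free module, given a derivative of `h`
that is a non-zero divisor on `D`. -/
theorem jacobianModule_eq_dual_of_free_relations (hh : h ≠ 0) (v : Fin n → OS n)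
    (hv : IsUnit (restrict h (∑ j, v j * partialDeriv j h)))
    (hfree : Module.Free (OS n) (relations h fun j => partialDeriv j h)) :
    IsFractionalIdealOn h (jacobianModule h) ∧ IsFractionalIdealOn h (residueModule h) ∧
      jacobianModule h = dual h (residueModule h) := by
  obtain ⟨ι, _, r, hr, hgen, hdd⟩ := exists_dual_generators (restrict h) hh restrict_eq_zero_iff
    (fun j => partialDeriv j h) v hv hfree
  have hR : residueModule h = Submodule.span (OD h) (Set.range r) := by
    refine le_antisymm (fun s hs => ?_) (Submodule.span_le.mpr ?_)
    · obtain ⟨w, rfl⟩ := hgen s ((mem_residueModule_iff hh v hv s).mp hs)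
      exact mem_span_of_eq_sum _ _
    · rintro _ ⟨k, rfl⟩
      exact (mem_residueModule_iff hh v hv _).mpr (hr k)
  refine ⟨⟨?_, _, ?_, hv.mem_nonZeroDivisors⟩, ⟨?_, 1, ?_, Submonoid.one_mem _⟩, ?_⟩
  · rw [jacobianModule_eq_span]
    exact Submodule.fg_span (Set.finite_range _)
  · rw [jacobianModule_eq_span, map_sum]
    simp only [map_mul]
    exact mem_span_of_eq_sum _ _
  · rw [hR]
    exact Submodule.fg_span (Set.finite_range _)
  -- `1` is the residue of `dh/h`.
  · exact (mem_residueModule_iff hh v hv _).mpr fun j => ⟨_, one_mul _⟩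
  -- `𝒥 ⊆ 𝒥^∨∨` is formal; the reverse inclusion is where the matrix factorization is used.
  · refine le_antisymm (fun f hf s hs => ?_) fun f hf => ?_
    · rw [residueModule_eq_dual hh v hv] at hs
      rw [mul_comm]
      exact hs f hf
    · rw [hR, mem_dual_span_iff] at hf
      obtain ⟨c, rfl⟩ := hdd f hf
      rw [jacobianModule_eq_span]
      exact mem_span_of_eq_sum _ _

end Residues

/-! ### Coordinates, and vector fields as combinations of partial derivatives -/

section Coordinates

variable {n : ℕ}

/-- The power series of a germ. -/
noncomputable def toSeries (n : ℕ) : OS n →ₐ[ℂ] MvPowerSeries (Fin n) ℂ := (convergentPowerSeries n).val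

theorem toSeries_injective : Function.Injective (toSeries n) := Subtype.val_injective

theorem isConvergent_toSeries (f : OS n) : IsConvergent (toSeries n f) := f.2

/-- The germ of a convergent power series. -/
def ofSeries (f : MvPowerSeries (Fin n) ℂ) (hf : IsConvergent f) : OS n := ⟨f, hf⟩

@[simp]
theorem toSeries_ofSeries (f : MvPowerSeries (Fin n) ℂ) (hf : IsConvergent f) :
    toSeries n (ofSeries f hf) = f := rfl

@[simp]
theorem toSeries_partialDeriv (i : Fin n) (f : OS n) :
    toSeries n (partialDeriv i f) = MvPowerSeries.pderiv ℂ i (toSeries n f) := rfl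

theorem IsConvergent.of_norm_le {f g : MvPowerSeries (Fin n) ℂ} (hf : IsConvergent f)
    (hfg : ∀ m, ‖MvPowerSeries.coeff m g‖ ≤ ‖MvPowerSeries.coeff m f‖) : IsConvergent g := by
  obtain ⟨r, hr, hs⟩ := hf
  exact ⟨r, hr, Summable.of_nonneg_of_le (fun m => by positivity)
    (fun m => by gcongr; exact hfg m) hs⟩

theorem isConvergent_monomial (m : Fin n →₀ ℕ) (c : ℂ) :
    IsConvergent (MvPowerSeries.monomial m c) := by
  classical
  refine ⟨1, one_pos, summable_of_ne_finset_zero (s := {m}) fun k hk => ?_⟩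
  rw [MvPowerSeries.coeff_monomial, if_neg (by simpa using hk)]
  simp

/-- The coordinate functions. -/
noncomputable def coord (i : Fin n) : OS n :=
  ofSeries (MvPowerSeries.X i) (isConvergent_monomial _ _)

@[simp]
theorem toSeries_coord (i : Fin n) : toSeries n (coord i) = MvPowerSeries.X i := rfl

theorem partialDeriv_coord (i j : Fin n) :
    partialDeriv i (coord j) = if j = i then 1 else 0 := by
  apply toSeries_injective
  rw [toSeries_partialDeriv, toSeries_coord, MvPowerSeries.pderiv_X]
  split_ifs <;> simp_all

theorem coeff_X_mul_eq_ite (i : Fin n) (m : Fin n →₀ ℕ) (f : MvPowerSeries (Fin n) ℂ) :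
    MvPowerSeries.coeff m (MvPowerSeries.X i * f) =
      if m i = 0 then 0 else MvPowerSeries.coeff (m - Finsupp.single i 1) f := by
  classical
  rw [MvPowerSeries.X_def, MvPowerSeries.coeff_monomial_mul, one_mul]
  simp only [Finsupp.single_le_iff, Nat.one_le_iff_ne_zero]
  split_ifs <;> simp_all

/-- Hadamard's lemma: a germ is its value at the origin plus a combination of the coordinates. -/
theorem exists_eq_algebraMap_add_sum_coord_mul (f : OS n) :
    ∃ (c : ℂ) (u : Fin n → OS n), f = algebraMap ℂ (OS n) c + ∑ i, coord i * u i := by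
  classical
  -- The series of `∫₀¹ (∂ᵢf)(tx) dt`. The coefficient of `x^m` in `xᵢ sᵢ` is `(mᵢ/|m|) f_m`, and `∑
  -- mᵢ = |m|`.
  let s (i : Fin n) : MvPowerSeries (Fin n) ℂ := fun m =>
    MvPowerSeries.coeff m (MvPowerSeries.pderiv ℂ i (toSeries n f)) / (m.degree + 1)
  have hcoeff (i : Fin n) (m : Fin n →₀ ℕ) : MvPowerSeries.coeff m (s i) =
    MvPowerSeries.coeff m (MvPowerSeries.pderiv ℂ i (toSeries n f)) / (m.degree + 1) := rfl
  have hs (i : Fin n) : IsConvergent (s i) := by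
    refine ((isConvergent_toSeries f).pderiv i).of_norm_le fun m => ?_
    rw [hcoeff, norm_div]
    refine div_le_self (norm_nonneg _) ?_
    have : ((m.degree : ℂ) + 1) = ((m.degree + 1 : ℕ) : ℂ) := by push_cast; rfl
    rw [this, Complex.norm_natCast]
    push_cast
    linarith [(Nat.cast_nonneg m.degree : (0 : ℝ) ≤ m.degree)]
  refine ⟨MvPowerSeries.constantCoeff (toSeries n f), fun i => ofSeries (s i) (hs i), ?_⟩
  apply toSeries_injective
  ext m
  simp only [map_add, map_sum, map_mul, toSeries_coord, toSeries_ofSeries, AlgHom.commutes]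
  rw [MvPowerSeries.algebraMap_apply, MvPowerSeries.coeff_C]
  have hterm (i : Fin n) : MvPowerSeries.coeff m (MvPowerSeries.X i * s i) =
      MvPowerSeries.coeff m (toSeries n f) * ((m i : ℂ) / m.degree) := by
    rw [coeff_X_mul_eq_ite]
    split_ifs with h0
    · simp [h0]
    · have hle : Finsupp.single i 1 ≤ m := by
        rw [Finsupp.single_le_iff]; omega
      have hdeg : (m - Finsupp.single i 1).degree + 1 = m.degree := by
        conv_rhs => rw [← tsub_add_cancel_of_le hle, map_add, Finsupp.degree_single]
      rw [hcoeff, MvPowerSeries.coeff_pderiv, tsub_add_cancel_of_le hle]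
      have h1 : (((m - Finsupp.single i 1 : Fin n →₀ ℕ) i : ℂ)) + 1 = m i := by
        have : (m - Finsupp.single i 1 : Fin n →₀ ℕ) i + 1 = m i := by
          simp only [Finsupp.coe_tsub, Pi.sub_apply, Finsupp.single_eq_same]
          omega
        exact_mod_cast this
      have h2 : ((m - Finsupp.single i 1 : Fin n →₀ ℕ).degree : ℂ) + 1 = m.degree := by
        exact_mod_cast hdeg
      rw [h1, h2, mul_div_assoc]
  rw [Finset.sum_congr rfl fun i _ => hterm i, ← Finset.mul_sum, ← Finset.sum_div]
  -- At `m = 0` the fraction `0/0` is `0`, so only the constant contributes.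
  split_ifs with h0
  · subst h0
    simp
  · have hd : (m.degree : ℂ) ≠ 0 := by
      rw [Nat.cast_ne_zero, Ne, Finsupp.degree_eq_zero_iff]
      exact h0
    rw [← Nat.cast_sum, ← Finsupp.degree_eq_sum, div_self hd]
    simp

theorem eq_zero_of_forall_coeff_eq_zero {f : OS n}
    (hf : ∀ k : ℕ, ∀ m : Fin n →₀ ℕ, m.degree < k → MvPowerSeries.coeff m (toSeries n f) = 0) :
    f = 0 := by
  apply toSeries_injective
  ext m
  rw [hf _ m (Nat.lt_succ_self _), map_zero, map_zero]

/-- A factor in the maximal ideal raises the order of vanishing by one. This drives the two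
determination arguments below, which therefore need no continuity. -/
theorem coeff_mul_eq_zero_of_degree_lt {f g : MvPowerSeries (Fin n) ℂ} {k : ℕ}
    (hf : MvPowerSeries.constantCoeff f = 0)
    (hg : ∀ m : Fin n →₀ ℕ, m.degree < k → MvPowerSeries.coeff m g = 0)
    (m : Fin n →₀ ℕ) (hm : m.degree < k + 1) : MvPowerSeries.coeff m (f * g) = 0 := by
  classical
  rw [MvPowerSeries.coeff_mul]
  refine Finset.sum_eq_zero fun p hp => ?_
  rw [Finset.HasAntidiagonal.mem_antidiagonal] at hp
  by_cases h0 : p.1 = 0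
  · rw [h0, MvPowerSeries.coeff_zero_eq_constantCoeff, hf, zero_mul]
  · rw [hg, mul_zero]
    have : p.1.degree ≠ 0 := by rwa [Ne, Finsupp.degree_eq_zero_iff]
    rw [← hp, map_add] at hm
    omega

/-- A derivation of `ℂ{x}` is determined by its values on the coordinates. -/
theorem derivation_eq_zero_of_coord (d : Derivation ℂ (OS n) (OS n)) (hd : ∀ i, d (coord i) = 0) :
    d = 0 := by
  -- For all `f` at once: `d f = ∑ xᵢ d(uᵢ)`, so vanishing to order `k` on every germ improves to
  -- order `k + 1`.
  have key : ∀ k : ℕ, ∀ f : OS n, ∀ m : Fin n →₀ ℕ, m.degree < k →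
      MvPowerSeries.coeff m (toSeries n (d f)) = 0 := by
    intro k
    induction k with
    | zero => intro f m hm; omega
    | succ k ih =>
      intro f m hm
      obtain ⟨c, u, rfl⟩ := exists_eq_algebraMap_add_sum_coord_mul f
      have h1 : d (algebraMap ℂ (OS n) c + ∑ i, coord i * u i) = ∑ i, coord i * d (u i) := by
        rw [map_add, Derivation.map_algebraMap, map_sum, zero_add]
        exact Finset.sum_congr rfl fun i _ => by
          rw [Derivation.leibniz, hd, smul_zero, add_zero, smul_eq_mul]
      rw [h1]
      simp only [map_sum, map_mul]
      exact Finset.sum_eq_zero fun i _ => coeff_mul_eq_zero_of_degree_lt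
        (by simp) (ih (u i)) m hm
  ext f
  exact eq_zero_of_forall_coeff_eq_zero fun k => key k f

/-- An algebra endomorphism of `ℂ{x}` is determined by its values on the coordinates, if these
vanish at the origin. -/
theorem algHom_ext_of_coord {φ ψ : OS n →ₐ[ℂ] OS n}
    (h0 : ∀ i, MvPowerSeries.constantCoeff (toSeries n (φ (coord i))) = 0)
    (h : ∀ i, φ (coord i) = ψ (coord i)) : φ = ψ := by
  have key : ∀ k : ℕ, ∀ f : OS n, ∀ m : Fin n →₀ ℕ, m.degree < k →
      MvPowerSeries.coeff m (toSeries n (φ f - ψ f)) = 0 := by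
    intro k
    induction k with
    | zero => intro f m hm; omega
    | succ k ih =>
      intro f m hm
      obtain ⟨c, u, rfl⟩ := exists_eq_algebraMap_add_sum_coord_mul f
      have h1 : φ (algebraMap ℂ (OS n) c + ∑ i, coord i * u i) -
          ψ (algebraMap ℂ (OS n) c + ∑ i, coord i * u i) =
            ∑ i, φ (coord i) * (φ (u i) - ψ (u i)) := by
        simp only [map_add, AlgHom.commutes, map_sum, map_mul, ← h, add_sub_add_left_eq_sub,
          mul_sub, Finset.sum_sub_distrib]
      rw [h1]
      simp only [map_sum, map_mul]
      exact Finset.sum_eq_zero fun i _ => coeff_mul_eq_zero_of_degree_lt (h0 i) (ih (u i)) m hm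
  refine AlgHom.ext fun f => sub_eq_zero.mp (eq_zero_of_forall_coeff_eq_zero fun k => key k f)

/-- The difference of the two sides kills the coordinates. -/
theorem derivation_eq_sum (d : Derivation ℂ (OS n) (OS n)) :
    d = ∑ i, d (coord i) • partialDeriv i := by
  rw [← sub_eq_zero]
  refine derivation_eq_zero_of_coord _ fun j => ?_
  rw [Derivation.sub_apply, sub_eq_zero, ← Derivation.coeFnAddMonoidHom_apply (∑ _, _), map_sum,
    Finset.sum_apply]
  simp [partialDeriv_coord]

/-- Logarithmic vector fields are the relations modulo `h` between its partial derivatives. -/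
noncomputable def logDerEquiv (h : OS n) :
    logDer h ≃ₗ[OS n] relations h fun j => partialDeriv j h := by
  have heq (δ : Derivation ℂ (OS n) (OS n)) :
      δ h = ∑ j, δ (coord j) * partialDeriv j h := by
    conv_lhs => rw [derivation_eq_sum δ, ← Derivation.coeFnAddMonoidHom_apply, map_sum,
      Finset.sum_apply]
    simp
  have hsum (c : Fin n → OS n) (f : OS n) :
      (∑ j, c j • partialDeriv j : Derivation ℂ (OS n) (OS n)) f = ∑ j, c j * partialDeriv j f := by
    rw [← Derivation.coeFnAddMonoidHom_apply, map_sum, Finset.sum_apply]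
    simp
  exact
    { toFun := fun δ => ⟨fun j => δ.1 (coord j), by
        rw [mem_relations, ← heq]
        exact Ideal.mem_span_singleton.mp δ.2⟩
      map_add' := fun _ _ => rfl
      map_smul' := fun _ _ => rfl
      invFun := fun c => ⟨∑ j, c.1 j • partialDeriv j, by
        refine Ideal.mem_span_singleton.mpr ?_
        rw [hsum]
        exact c.2⟩
      left_inv := fun δ => Subtype.ext (derivation_eq_sum δ.1).symm
      right_inv := fun c => Subtype.ext <| funext fun j => by
        simp only [hsum, partialDeriv_coord]
        simp }

end Coordinates

/-! ### Weighted norms on polydiscs and the Neumann series -/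

section WeightedNorm

open scoped NNReal ENNReal

variable {n : ℕ}

/-- The value of the monomial `x^m` at the polyradius `ρ`. -/
noncomputable def monomialWeight (ρ : Fin n → ℝ≥0) (m : Fin n →₀ ℕ) : ℝ≥0 := ∏ i, ρ i ^ m i

theorem monomialWeight_add (ρ : Fin n → ℝ≥0) (m k : Fin n →₀ ℕ) :
    monomialWeight ρ (m + k) = monomialWeight ρ m * monomialWeight ρ k := by
  simp [monomialWeight, pow_add, Finset.prod_mul_distrib]

theorem monomialWeight_mul (ρ η : Fin n → ℝ≥0) (m : Fin n →₀ ℕ) :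
    monomialWeight (ρ * η) m = monomialWeight ρ m * monomialWeight η m := by
  simp [monomialWeight, mul_pow, Finset.prod_mul_distrib]

theorem monomialWeight_single (ρ : Fin n → ℝ≥0) (e : Fin n) (d : ℕ) :
    monomialWeight ρ (Finsupp.single e d) = ρ e ^ d := by
  classical
  rw [monomialWeight, Finset.prod_eq_single e]
  · simp
  · intro i _ hi
    simp [Finsupp.single_eq_of_ne hi]
  · simp

theorem monomialWeight_const (r : ℝ≥0) (m : Fin n →₀ ℕ) :
    monomialWeight (fun _ => r) m = r ^ m.degree := by
  rw [monomialWeight, Finset.prod_pow_eq_pow_sum, Finsupp.degree_eq_sum]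

theorem monomialWeight_pos {ρ : Fin n → ℝ≥0} (hρ : ∀ i, 0 < ρ i) (m : Fin n →₀ ℕ) :
    0 < monomialWeight ρ m :=
  Finset.prod_pos fun i _ => pow_pos (hρ i) _

theorem monomialWeight_mono {ρ η : Fin n → ℝ≥0} (h : ρ ≤ η) (m : Fin n →₀ ℕ) :
    monomialWeight ρ m ≤ monomialWeight η m :=
  Finset.prod_le_prod' fun i _ => pow_le_pow_left' (h i) _

theorem monomialWeight_le_pow {ρ : Fin n → ℝ≥0} (h : ∀ i, ρ i ≤ 1) (m : Fin n →₀ ℕ) (i : Fin n) :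
    monomialWeight ρ m ≤ ρ i ^ m i := by
  classical
  rw [monomialWeight, ← Finset.mul_prod_erase _ _ (Finset.mem_univ i)]
  exact mul_le_of_le_one_right' (Finset.prod_le_one' fun j _ => pow_le_one' (h j) _)

/-- The weighted `ℓ¹`-norm of a power series on the polydisc of polyradius `ρ`. -/
noncomputable def wnorm (ρ : Fin n → ℝ≥0) (f : MvPowerSeries (Fin n) ℂ) : ℝ≥0∞ :=
  ∑' m : Fin n →₀ ℕ, ‖MvPowerSeries.coeff m f‖ₑ * monomialWeight ρ m

theorem le_wnorm (ρ : Fin n → ℝ≥0) (f : MvPowerSeries (Fin n) ℂ) (m : Fin n →₀ ℕ) :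
    ‖MvPowerSeries.coeff m f‖ₑ * monomialWeight ρ m ≤ wnorm ρ f :=
  ENNReal.le_tsum (f := fun m => ‖MvPowerSeries.coeff m f‖ₑ * monomialWeight ρ m) m

theorem eq_zero_of_wnorm_eq_zero {ρ : Fin n → ℝ≥0} (hρ : ∀ i, 0 < ρ i)
    {f : MvPowerSeries (Fin n) ℂ} (hf : wnorm ρ f = 0) : f = 0 := by
  ext m
  have := le_wnorm ρ f m
  rw [hf, nonpos_iff_eq_zero, mul_eq_zero, ENNReal.coe_eq_zero] at this
  simpa using this.resolve_right (monomialWeight_pos hρ m).ne'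

theorem wnorm_mono {ρ η : Fin n → ℝ≥0} (h : ρ ≤ η) (f : MvPowerSeries (Fin n) ℂ) :
    wnorm ρ f ≤ wnorm η f :=
  ENNReal.tsum_le_tsum fun m => by gcongr; exact monomialWeight_mono h m

theorem wnorm_add_le (ρ : Fin n → ℝ≥0) (f g : MvPowerSeries (Fin n) ℂ) :
    wnorm ρ (f + g) ≤ wnorm ρ f + wnorm ρ g := by
  rw [wnorm, wnorm, wnorm, ← ENNReal.tsum_add]
  refine ENNReal.tsum_le_tsum fun m => ?_
  rw [← add_mul, map_add]
  gcongr
  exact enorm_add_le _ _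

theorem wnorm_sub_le (ρ : Fin n → ℝ≥0) (f g : MvPowerSeries (Fin n) ℂ) :
    wnorm ρ (f - g) ≤ wnorm ρ f + wnorm ρ g := by
  rw [wnorm, wnorm, wnorm, ← ENNReal.tsum_add]
  refine ENNReal.tsum_le_tsum fun m => ?_
  rw [← add_mul, map_sub]
  gcongr
  exact enorm_sub_le

theorem wnorm_mul_le (ρ : Fin n → ℝ≥0) (f g : MvPowerSeries (Fin n) ℂ) :
    wnorm ρ (f * g) ≤ wnorm ρ f * wnorm ρ g := by
  classical
  calc wnorm ρ (f * g)
      ≤ ∑' m : Fin n →₀ ℕ, ∑' p : Finset.HasAntidiagonal.antidiagonal m,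
          (‖MvPowerSeries.coeff p.1.1 f‖ₑ * monomialWeight ρ p.1.1) *
            (‖MvPowerSeries.coeff p.1.2 g‖ₑ * monomialWeight ρ p.1.2) := by
        refine ENNReal.tsum_le_tsum fun m => ?_
        rw [Finset.tsum_subtype (Finset.HasAntidiagonal.antidiagonal m) fun p =>
          (‖MvPowerSeries.coeff p.1 f‖ₑ * monomialWeight ρ p.1) *
            (‖MvPowerSeries.coeff p.2 g‖ₑ * monomialWeight ρ p.2), MvPowerSeries.coeff_mul]
        calc _ ≤ (∑ p ∈ Finset.HasAntidiagonal.antidiagonal m,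
              ‖MvPowerSeries.coeff p.1 f‖ₑ * ‖MvPowerSeries.coeff p.2 g‖ₑ) *
                monomialWeight ρ m := by
              gcongr
              exact (enorm_sum_le _ _).trans (Finset.sum_le_sum fun p _ => (enorm_mul _ _).le)
          _ = _ := by
              rw [Finset.sum_mul]
              refine Finset.sum_congr rfl fun p hp => ?_
              rw [← Finset.HasAntidiagonal.mem_antidiagonal.mp hp, monomialWeight_add,
                ENNReal.coe_mul]
              ring
    _ = ∑' p : (Fin n →₀ ℕ) × (Fin n →₀ ℕ),
          (‖MvPowerSeries.coeff p.1 f‖ₑ * monomialWeight ρ p.1) *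
            (‖MvPowerSeries.coeff p.2 g‖ₑ * monomialWeight ρ p.2) := by
        rw [← Finset.HasAntidiagonal.sigmaAntidiagonalEquivProd.tsum_eq, ENNReal.tsum_sigma']
        rfl
    _ = wnorm ρ f * wnorm ρ g := by
        rw [ENNReal.tsum_prod']
        simp_rw [ENNReal.tsum_mul_left, ENNReal.tsum_mul_right]
        rfl

theorem isConvergent_iff_wnorm_lt_top (f : MvPowerSeries (Fin n) ℂ) :
    IsConvergent f ↔ ∃ r : ℝ≥0, 0 < r ∧ wnorm (fun _ => r) f < ∞ := by
  have key (r : ℝ≥0) : wnorm (fun _ => r) f < ∞ ↔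
      Summable fun m : Fin n →₀ ℕ => ‖MvPowerSeries.coeff m f‖ * (r : ℝ) ^ m.degree := by
    have h1 : wnorm (fun _ => r) f =
        ∑' m : Fin n →₀ ℕ, ((‖MvPowerSeries.coeff m f‖₊ * r ^ m.degree : ℝ≥0) : ℝ≥0∞) := by
      refine tsum_congr fun m => ?_
      rw [monomialWeight_const, ENNReal.coe_mul]
      rfl
    rw [h1, lt_top_iff_ne_top, ENNReal.tsum_coe_ne_top_iff_summable, ← NNReal.summable_coe]
    simp
  constructor
  · rintro ⟨r, hr, h⟩
    exact ⟨⟨r, hr.le⟩, hr, (key _).mpr h⟩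
  · rintro ⟨r, hr, h⟩
    exact ⟨r, hr, (key r).mp h⟩

theorem isConvergent_of_wnorm_lt_top {ρ : Fin n → ℝ≥0} (hρ : ∀ i, 0 < ρ i)
    {f : MvPowerSeries (Fin n) ℂ} (hf : wnorm ρ f < ∞) : IsConvergent f := by
  rw [isConvergent_iff_wnorm_lt_top]
  obtain ⟨r, hr, hle⟩ : ∃ r : ℝ≥0, 0 < r ∧ ∀ i, r ≤ ρ i := by
    -- A product of numbers at most `1` lies below each factor; this also covers `n = 0`.
    refine ⟨∏ i, min 1 (ρ i), Finset.prod_pos fun i _ => lt_min one_pos (hρ i), fun i => ?_⟩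
    have := monomialWeight_le_pow (ρ := fun i => min 1 (ρ i)) (fun i => min_le_left _ _)
      (Finsupp.equivFunOnFinite.symm 1) i
    simp only [monomialWeight, Finsupp.equivFunOnFinite_symm_apply_apply, Pi.one_apply,
      pow_one] at this
    exact this.trans (min_le_right _ _)
  exact ⟨r, hr, (wnorm_mono hle f).trans_lt hf⟩

/-- The quotient by `x_e^d`, discarding the monomials not divisible by it. -/
noncomputable def shiftDown (e : Fin n) (d : ℕ) :
    MvPowerSeries (Fin n) ℂ →ₗ[ℂ] MvPowerSeries (Fin n) ℂ where
  toFun f := fun m => MvPowerSeries.coeff (m + Finsupp.single e d) f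
  map_add' _ _ := rfl
  map_smul' _ _ := rfl

@[simp]
theorem coeff_shiftDown (e : Fin n) (d : ℕ) (f : MvPowerSeries (Fin n) ℂ) (m : Fin n →₀ ℕ) :
    MvPowerSeries.coeff m (shiftDown e d f) =
      MvPowerSeries.coeff (m + Finsupp.single e d) f := rfl

/-- The left side is the part of the sum for `f` over the monomials divisible by `x_e^d`. -/
theorem wnorm_shiftDown_mul_le (ρ : Fin n → ℝ≥0) (e : Fin n) (d : ℕ)
    (f : MvPowerSeries (Fin n) ℂ) :
    wnorm ρ (shiftDown e d f) * (ρ e ^ d : ℝ≥0) ≤ wnorm ρ f := by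
  rw [wnorm, ← ENNReal.tsum_mul_right]
  refine le_trans (ENNReal.tsum_le_tsum fun m => le_of_eq ?_)
    (ENNReal.tsum_comp_le_tsum_of_injective (add_left_injective (Finsupp.single e d))
      fun m => ‖MvPowerSeries.coeff m f‖ₑ * monomialWeight ρ m)
  rw [coeff_shiftDown, monomialWeight_add, monomialWeight_single, ENNReal.coe_mul, mul_assoc]

theorem IsConvergent.shiftDown {f : MvPowerSeries (Fin n) ℂ} (hf : IsConvergent f) (e : Fin n)
    (d : ℕ) : IsConvergent (shiftDown e d f) := by
  rw [isConvergent_iff_wnorm_lt_top] at hf ⊢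
  obtain ⟨r, hr, hf⟩ := hf
  refine ⟨r, hr, ?_⟩
  have h1 := (wnorm_shiftDown_mul_le (fun _ => r) e d f).trans_lt hf
  exact ENNReal.lt_top_of_mul_ne_top_left h1.ne (by
    rw [Ne, ENNReal.coe_eq_zero]; exact (pow_pos hr d).ne')

/-- A coefficientwise sum of power series whose norms are summable. -/
theorem wnorm_tsum_coeff_le (ρ : Fin n → ℝ≥0) (u : ℕ → MvPowerSeries (Fin n) ℂ) :
    wnorm ρ (fun m => ∑' k, MvPowerSeries.coeff m (u k)) ≤ ∑' k, wnorm ρ (u k) := by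
  simp only [wnorm]
  rw [ENNReal.tsum_comm]
  refine ENNReal.tsum_le_tsum fun m => ?_
  rw [ENNReal.tsum_mul_right]
  gcongr
  exact enorm_tsum_le_tsum_enorm

theorem summable_coeff_of_wnorm {ρ : Fin n → ℝ≥0} (hρ : ∀ i, 0 < ρ i)
    {u : ℕ → MvPowerSeries (Fin n) ℂ} (hu : ∑' k, wnorm ρ (u k) < ∞) (m : Fin n →₀ ℕ) :
    Summable fun k => MvPowerSeries.coeff m (u k) := by
  refine Summable.of_nnnorm ?_
  rw [← ENNReal.tsum_coe_ne_top_iff_summable]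
  have h1 : (∑' k, ‖MvPowerSeries.coeff m (u k)‖ₑ) * monomialWeight ρ m < ∞ := by
    rw [← ENNReal.tsum_mul_right]
    exact (ENNReal.tsum_le_tsum fun k => le_wnorm ρ (u k) m).trans_lt hu
  exact (ENNReal.lt_top_of_mul_ne_top_left h1.ne (by
    rw [Ne, ENNReal.coe_eq_zero]; exact (monomialWeight_pos hρ m).ne')).ne

/-- The Neumann series: `1 - E` is surjective if `E` is a contraction by `1/2`. -/
theorem exists_sub_apply_eq {ρ : Fin n → ℝ≥0} (hρ : ∀ i, 0 < ρ i)
    (E : MvPowerSeries (Fin n) ℂ →ₗ[ℂ] MvPowerSeries (Fin n) ℂ)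
    (hE : ∀ f, wnorm ρ (E f) ≤ 2⁻¹ * wnorm ρ f) {f : MvPowerSeries (Fin n) ℂ}
    (hf : wnorm ρ f < ∞) : ∃ F, wnorm ρ F < ∞ ∧ F - E F = f := by
  have hpow (k : ℕ) : wnorm ρ ((E ^ k) f) ≤ 2⁻¹ ^ k * wnorm ρ f := by
    induction k with
    | zero => simp
    | succ k ih =>
      rw [pow_succ', Module.End.mul_apply, pow_succ', mul_assoc]
      exact (hE _).trans (by gcongr)
  have htail (K : ℕ) : ∑' k, wnorm ρ ((E ^ (k + K)) f) ≤ 2⁻¹ ^ K * (2 * wnorm ρ f) := by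
    calc _ ≤ ∑' k : ℕ, 2⁻¹ ^ k * (2⁻¹ ^ K * wnorm ρ f) :=
          ENNReal.tsum_le_tsum fun k => (hpow _).trans (by rw [pow_add, mul_assoc])
      _ = _ := by
          rw [ENNReal.tsum_mul_right, ENNReal.tsum_geometric, ENNReal.one_sub_inv_two, inv_inv]
          ring
  have hfin : ∑' k, wnorm ρ ((E ^ k) f) < ∞ := by
    refine (htail 0).trans_lt ?_
    rw [pow_zero, one_mul]
    exact ENNReal.mul_lt_top (by simp) hf
  -- The sum `∑ E^k f` is formed coefficientwise, so that `E` commutes with it is not automatic; the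
  -- tail estimates replace this.
  let F : MvPowerSeries (Fin n) ℂ := fun m => ∑' k, MvPowerSeries.coeff m ((E ^ k) f)
  have hFK (K : ℕ) : wnorm ρ (F - ∑ k ∈ Finset.range K, (E ^ k) f) ≤
      2⁻¹ ^ K * (2 * wnorm ρ f) := by
    refine le_trans ?_ ((wnorm_tsum_coeff_le ρ fun k => (E ^ (k + K)) f).trans (htail K))
    refine le_of_eq (congrArg _ ?_)
    ext m
    have := (summable_coeff_of_wnorm hρ hfin m).sum_add_tsum_nat_add K
    rw [map_sub, map_sum, sub_eq_iff_eq_add']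
    exact this.symm
  refine ⟨F, (wnorm_tsum_coeff_le ρ _).trans_lt hfin, ?_⟩
  rw [← sub_eq_zero]
  refine eq_zero_of_wnorm_eq_zero hρ (nonpos_iff_eq_zero.mp ?_)
  -- `5 = 2 + 2 + 1`: the bounds for `F - S`, `E (F - S)` and `E^K f`, with `S` the `K`-th partial
  -- sum.
  have hlim : Filter.Tendsto (fun K : ℕ => (2⁻¹ : ℝ≥0∞) ^ K * (5 * wnorm ρ f)) Filter.atTop
      (nhds 0) := by
    have := ENNReal.Tendsto.mul_const (b := 5 * wnorm ρ f)
      (ENNReal.tendsto_pow_atTop_nhds_zero_of_lt_one (r := 2⁻¹) (by simp))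
      (Or.inr (ENNReal.mul_lt_top (by simp) hf).ne)
    rwa [zero_mul] at this
  refine ge_of_tendsto' hlim fun K => ?_
  set S := ∑ k ∈ Finset.range K, (E ^ k) f with hS
  have hSE : S - E S = f - (E ^ K) f := by
    rw [hS, map_sum, ← Finset.sum_sub_distrib]
    have := Finset.sum_range_sub' (fun k => (E ^ k) f) K
    simp only [pow_succ', Module.End.mul_apply, pow_zero, Module.End.one_apply] at this ⊢
    exact this
  have hdecomp : F - E F - f = ((F - S) - E (F - S)) - (E ^ K) f := by
    rw [map_sub]
    linear_combination hSE
  rw [hdecomp]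
  refine (wnorm_sub_le _ _ _).trans ?_
  have h1 : wnorm ρ (E (F - S)) ≤ 2⁻¹ ^ K * (2 * wnorm ρ f) :=
    (hE _).trans ((mul_le_of_le_one_left' (by simp)).trans (hFK K))
  calc _ ≤ (2⁻¹ ^ K * (2 * wnorm ρ f) + 2⁻¹ ^ K * (2 * wnorm ρ f)) + 2⁻¹ ^ K * wnorm ρ f :=
        add_le_add ((wnorm_sub_le _ _ _).trans (add_le_add (hFK K) h1)) (hpow K)
    _ = _ := by ring

theorem eq_zero_of_apply_eq_self {ρ : Fin n → ℝ≥0} (hρ : ∀ i, 0 < ρ i)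
    {E : MvPowerSeries (Fin n) ℂ →ₗ[ℂ] MvPowerSeries (Fin n) ℂ}
    (hE : ∀ f, wnorm ρ (E f) ≤ 2⁻¹ * wnorm ρ f) {F : MvPowerSeries (Fin n) ℂ}
    (hF : wnorm ρ F < ∞) (h : E F = F) : F = 0 := by
  refine eq_zero_of_wnorm_eq_zero hρ ?_
  by_contra h0
  have h1 := hE F
  rw [h, mul_comm, ← div_eq_mul_inv] at h1
  exact absurd h1 (not_le.mpr (ENNReal.half_lt_self h0 hF.ne))

/-- A series without pure powers of `x_e` of degree at most `d` is small compared to `x_e^d` on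
suitable polydiscs. -/
theorem exists_polyradius (e : Fin n) (d : ℕ) {P : MvPowerSeries (Fin n) ℂ}
    (h0 : ∀ j ≤ d, MvPowerSeries.coeff (Finsupp.single e j) P = 0) {r : ℝ≥0} (hr : 0 < r)
    (hP : wnorm (fun _ => r) P < ∞) :
    ∃ ρ : Fin n → ℝ≥0, (∀ i, 0 < ρ i) ∧ (∀ i, ρ i ≤ r) ∧
      wnorm ρ P ≤ 2⁻¹ * (ρ e ^ d : ℝ≥0) := by
  classical
  lift wnorm (fun _ => r) P to ℝ≥0 using hP.ne with C hC
  -- Chosen so that `ε C ≤ r^d / 2`; the `+ 1` keeps the denominator non-zero when `C = 0`.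
  let ε : ℝ≥0 := min 1 (r ^ d / (2 * (C + 1)))
  have hε0 : 0 < ε := lt_min one_pos (div_pos (pow_pos hr d) (by positivity))
  have hε1 : ε ≤ 1 := min_le_left _ _
  have hεC : ε * C ≤ 2⁻¹ * r ^ d := by
    calc ε * C ≤ (r ^ d / (2 * (C + 1))) * (C + 1) := by
          gcongr
          · exact min_le_right _ _
          · exact le_self_add
      _ = 2⁻¹ * r ^ d := by field_simp
  -- Every monomial of `P` involves a variable other than `x_e` or is a power of `x_e` beyond the
  -- `d`-th, so it shrinks by at least `ε^(d+1)`, whereas `x_e^d` shrinks by only `ε^d`.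
  let η : Fin n → ℝ≥0 := fun i => if i = e then ε else ε ^ (d + 1)
  have hη0 (i : Fin n) : 0 < η i := by
    simp only [η]; split_ifs; exacts [hε0, pow_pos hε0 _]
  have hη1 (i : Fin n) : η i ≤ 1 := by
    simp only [η]; split_ifs; exacts [hε1, pow_le_one' hε1 _]
  refine ⟨(fun _ => r) * η, fun i => mul_pos hr (hη0 i), fun i => mul_le_of_le_one_right' (hη1 i),
    ?_⟩
  have hbound (m : Fin n →₀ ℕ) (hm : MvPowerSeries.coeff m P ≠ 0) :
      monomialWeight η m ≤ ε ^ (d + 1) := by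
    by_cases hex : ∃ i, i ≠ e ∧ m i ≠ 0
    · obtain ⟨i, hi, hmi⟩ := hex
      refine (monomialWeight_le_pow hη1 m i).trans ?_
      simp only [η, if_neg hi]
      exact pow_le_of_le_one zero_le (pow_le_one' hε1 _) hmi
    · push Not at hex
      have hme : m = Finsupp.single e (m e) := by
        ext i
        by_cases hi : i = e
        · subst hi; simp
        · rw [hex i hi, Finsupp.single_eq_of_ne hi]
      have hd : d + 1 ≤ m e := by
        by_contra hlt
        exact hm (by rw [hme]; exact h0 _ (by omega))
      refine (monomialWeight_le_pow hη1 m e).trans ?_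
      simp only [η, if_true]
      exact pow_le_pow_right_of_le_one' hε1 hd
  calc wnorm ((fun _ => r) * η) P
      ≤ ∑' m : Fin n →₀ ℕ, (‖MvPowerSeries.coeff m P‖ₑ * monomialWeight (fun _ => r) m) *
          (ε ^ (d + 1) : ℝ≥0) := by
        refine ENNReal.tsum_le_tsum fun m => ?_
        by_cases hm : MvPowerSeries.coeff m P = 0
        · simp [hm]
        · rw [monomialWeight_mul, ENNReal.coe_mul, mul_assoc]
          gcongr
          exact hbound m hm
    _ = ((C * ε ^ (d + 1) : ℝ≥0) : ℝ≥0∞) := by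
        rw [ENNReal.tsum_mul_right, ENNReal.coe_mul, hC]
        rfl
    _ ≤ ((2⁻¹ * (r * ε) ^ d : ℝ≥0) : ℝ≥0∞) := by
        rw [ENNReal.coe_le_coe]
        calc C * ε ^ (d + 1) = (ε * C) * ε ^ d := by ring
          _ ≤ (2⁻¹ * r ^ d) * ε ^ d := by gcongr
          _ = _ := by ring
    _ = _ := by
        rw [ENNReal.coe_mul, ENNReal.coe_inv (by norm_num)]
        simp [η]

end WeightedNorm

/-! ### Weierstrass division -/

section WeierstrassDivision

open scoped NNReal ENNReal

variable {n : ℕ}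

/-- The remainder of division by `x_e^d`. -/
noncomputable def lowPart (e : Fin n) (d : ℕ) (f : MvPowerSeries (Fin n) ℂ) :
    MvPowerSeries (Fin n) ℂ :=
  fun m => if m e < d then MvPowerSeries.coeff m f else 0

theorem coeff_lowPart (e : Fin n) (d : ℕ) (f : MvPowerSeries (Fin n) ℂ) (m : Fin n →₀ ℕ) :
    MvPowerSeries.coeff m (lowPart e d f) = if m e < d then MvPowerSeries.coeff m f else 0 := rfl

theorem IsConvergent.lowPart {f : MvPowerSeries (Fin n) ℂ} (hf : IsConvergent f) (e : Fin n)
    (d : ℕ) : IsConvergent (lowPart e d f) := by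
  refine hf.of_norm_le fun m => ?_
  rw [coeff_lowPart]
  split_ifs <;> simp

theorem coeff_mul_X_pow_eq_ite (e : Fin n) (d : ℕ) (f : MvPowerSeries (Fin n) ℂ)
    (m : Fin n →₀ ℕ) : MvPowerSeries.coeff m (f * MvPowerSeries.X e ^ d) =
      if d ≤ m e then MvPowerSeries.coeff (m - Finsupp.single e d) f else 0 := by
  classical
  rw [MvPowerSeries.X_pow_eq, MvPowerSeries.coeff_mul_monomial, mul_one]
  simp only [Finsupp.single_le_iff]

theorem eq_shiftDown_mul_add_lowPart (e : Fin n) (d : ℕ) (f : MvPowerSeries (Fin n) ℂ) :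
    f = shiftDown e d f * MvPowerSeries.X e ^ d + lowPart e d f := by
  ext m
  rw [map_add, coeff_mul_X_pow_eq_ite, coeff_lowPart]
  by_cases hm : d ≤ m e
  · rw [if_pos hm, if_neg (by omega), add_zero, coeff_shiftDown,
      tsub_add_cancel_of_le (by rwa [Finsupp.single_le_iff])]
  · rw [if_neg hm, if_pos (by omega), zero_add]

theorem shiftDown_mul_X_pow_add (e : Fin n) (d : ℕ) (q r : MvPowerSeries (Fin n) ℂ)
    (hr : ∀ m : Fin n →₀ ℕ, d ≤ m e → MvPowerSeries.coeff m r = 0) :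
    shiftDown e d (q * MvPowerSeries.X e ^ d + r) = q := by
  ext m
  rw [coeff_shiftDown, map_add, coeff_mul_X_pow_eq_ite, if_pos (by simp), hr _ (by simp),
    add_zero, add_tsub_cancel_right]

/-- The germ `h` is regular of order `d` in `x_e`. -/
def IsRegularIn (e : Fin n) (d : ℕ) (h : OS n) : Prop :=
  (∀ j < d, MvPowerSeries.coeff (Finsupp.single e j) (toSeries n h) = 0) ∧
    MvPowerSeries.coeff (Finsupp.single e d) (toSeries n h) ≠ 0

/-- Division by `x_e^d` is trivial, and replacing `x_e^d` by `c⁻¹ h`, with `c` the leading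
coefficient on the axis, changes the identity by `E f = shiftDown e d f * P` with `P = x_e^d - c⁻¹
h`. By regularity `P` has no pure power of `x_e` up to degree `d`, so `E` contracts on a suitable
polydisc. The series `u` is carried along to have finite norm on that same polydisc. -/
theorem IsRegularIn.exists_contraction {e : Fin n} {d : ℕ} {h : OS n} (hreg : IsRegularIn e d h)
    {u : MvPowerSeries (Fin n) ℂ} (hu : IsConvergent u) :
    ∃ (ρ : Fin n → ℝ≥0) (E : MvPowerSeries (Fin n) ℂ →ₗ[ℂ] MvPowerSeries (Fin n) ℂ),
      (∀ i, 0 < ρ i) ∧ wnorm ρ u < ∞ ∧ (∀ f, wnorm ρ (E f) ≤ 2⁻¹ * wnorm ρ f) ∧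
      ∀ f, f - E f = lowPart e d f +
        (MvPowerSeries.coeff (Finsupp.single e d) (toSeries n h))⁻¹ •
          (shiftDown e d f * toSeries n h) := by
  classical
  set c := MvPowerSeries.coeff (Finsupp.single e d) (toSeries n h) with hc
  let P : OS n := coord e ^ d - c⁻¹ • h
  have hP : toSeries n P = MvPowerSeries.X e ^ d - c⁻¹ • toSeries n h := by
    simp only [P, map_sub, map_pow, map_smul, toSeries_coord]
  have hP0 : ∀ j ≤ d, MvPowerSeries.coeff (Finsupp.single e j) (toSeries n P) = 0 := by
    intro j hj
    rw [hP, map_sub, MvPowerSeries.coeff_smul, MvPowerSeries.coeff_X_pow]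
    rcases hj.lt_or_eq with hj | rfl
    · rw [hreg.1 j hj, if_neg, mul_zero, sub_zero]
      exact fun h => hj.ne (Finsupp.single_injective e h)
    · rw [← hc, if_pos rfl, inv_mul_cancel₀ hreg.2, sub_self]
  obtain ⟨r₁, hr₁, hP₁⟩ := (isConvergent_iff_wnorm_lt_top _).mp (isConvergent_toSeries P)
  obtain ⟨r₂, hr₂, hu₂⟩ := (isConvergent_iff_wnorm_lt_top _).mp hu
  obtain ⟨ρ, hρ0, hρr, hρ⟩ := exists_polyradius e d hP0 (lt_min hr₁ hr₂)
    ((wnorm_mono (fun _ => min_le_left r₁ r₂) _).trans_lt hP₁)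
  refine ⟨ρ, (LinearMap.mulRight ℂ (toSeries n P)).comp (shiftDown e d), hρ0, ?_, fun f => ?_, fun f => ?_⟩
  · exact (wnorm_mono (fun i => (hρr i).trans (min_le_right r₁ r₂)) _).trans_lt hu₂
  · rw [LinearMap.comp_apply, LinearMap.mulRight_apply]
    calc _ ≤ wnorm ρ (shiftDown e d f) * (2⁻¹ * (ρ e ^ d : ℝ≥0)) :=
          (wnorm_mul_le _ _ _).trans (by gcongr)
      _ = 2⁻¹ * (wnorm ρ (shiftDown e d f) * (ρ e ^ d : ℝ≥0)) := by ring
      _ ≤ _ := by gcongr; exact wnorm_shiftDown_mul_le ρ e d f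
  · rw [LinearMap.comp_apply, LinearMap.mulRight_apply, hP, mul_sub, mul_smul_comm]
    conv_lhs => enter [1]; rw [eq_shiftDown_mul_add_lowPart e d f]
    ring

/-- Weierstrass division by a germ that is regular in `x_e`. -/
theorem IsRegularIn.exists_division {e : Fin n} {d : ℕ} {h : OS n} (hreg : IsRegularIn e d h)
    (f : OS n) : ∃ q r : OS n, f = q * h + r ∧
      ∀ m : Fin n →₀ ℕ, d ≤ m e → MvPowerSeries.coeff m (toSeries n r) = 0 := by
  obtain ⟨ρ, E, hρ, hf, hE, hdec⟩ := hreg.exists_contraction (isConvergent_toSeries f)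
  -- Solving `F - E F = f` is the division: the two parts of `F` give remainder and quotient.
  obtain ⟨F, hF, hFf⟩ := exists_sub_apply_eq hρ E hE hf
  have hF' := isConvergent_of_wnorm_lt_top hρ hF
  refine ⟨(MvPowerSeries.coeff (Finsupp.single e d) (toSeries n h))⁻¹ •
    ofSeries _ (hF'.shiftDown e d), ofSeries _ (hF'.lowPart e d),
    ?_, fun m hm => ?_⟩
  · apply toSeries_injective
    rw [map_add, map_mul, map_smul, toSeries_ofSeries, toSeries_ofSeries, smul_mul_assoc, ← hFf, hdec, add_comm]
  · rw [toSeries_ofSeries, coeff_lowPart, if_neg (by omega)]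

/-- Uniqueness in Weierstrass division. -/
theorem IsRegularIn.remainder_eq_zero {e : Fin n} {d : ℕ} {h : OS n} (hreg : IsRegularIn e d h)
    {r : OS n} (hr : ∀ m : Fin n →₀ ℕ, d ≤ m e → MvPowerSeries.coeff m (toSeries n r) = 0)
    (hdvd : h ∣ r) : r = 0 := by
  obtain ⟨q, hq⟩ := hdvd
  set c := MvPowerSeries.coeff (Finsupp.single e d) (toSeries n h) with hc
  -- Built to have quotient `-c q` and remainder `r` modulo `x_e^d`, so that `F - E F = r - q h =
  -- 0`.
  let F : OS n := (-(c • q)) * coord e ^ d + r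
  have hF : toSeries n F = toSeries n (-(c • q)) * MvPowerSeries.X e ^ d + toSeries n r := by
    simp only [F, map_add, map_mul, map_pow, toSeries_coord]
  obtain ⟨ρ, E, hρ, hρF, hE, hdec⟩ := hreg.exists_contraction (isConvergent_toSeries F)
  have hshift : shiftDown e d (toSeries n F) = toSeries n (-(c • q)) := by
    rw [hF, shiftDown_mul_X_pow_add _ _ _ _ hr]
  have hlow : lowPart e d (toSeries n F) = toSeries n r := by
    have := eq_shiftDown_mul_add_lowPart e d (toSeries n F)
    rw [hshift] at this
    conv_lhs at this => rw [hF]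
    exact (add_left_cancel this).symm
  have hfix : E (toSeries n F) = toSeries n F := by
    rw [eq_comm, ← sub_eq_zero, hdec, hshift, hlow, ← hc, hq]
    simp only [map_neg, map_smul, map_mul, neg_mul, smul_neg, smul_mul_assoc,
      inv_smul_smul₀ (show c ≠ 0 from hreg.2)]
    ring
  have h0 := eq_zero_of_apply_eq_self hρ hE hρF hfix
  apply toSeries_injective
  rw [← hlow, h0, map_zero]
  ext m
  simp [coeff_lowPart]

end WeierstrassDivision

/-! ### Weierstrass polynomial, discriminant argument and reducedness -/

section WeierstrassPolynomial

open Polynomial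

variable {n : ℕ}

/-- The germs that do not depend on `x_e`. -/
noncomputable def independentOf (e : Fin n) : Subalgebra ℂ (OS n) where
  carrier := {f | partialDeriv e f = 0}
  mul_mem' {f g} hf hg := by
    simp only [Set.mem_ofPred_eq] at *
    rw [Derivation.leibniz, hf, hg, smul_zero, smul_zero, add_zero]
  add_mem' {f g} hf hg := by
    simp only [Set.mem_ofPred_eq] at *
    rw [map_add, hf, hg, add_zero]
  algebraMap_mem' c := (partialDeriv e).map_algebraMap c

theorem coeff_eq_zero_of_mem_independentOf {e : Fin n} (b : independentOf e) {m : Fin n →₀ ℕ}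
    (hm : m e ≠ 0) : MvPowerSeries.coeff m (toSeries n b) = 0 := by
  have h1 : MvPowerSeries.coeff (m - Finsupp.single e 1)
      (MvPowerSeries.pderiv ℂ e (toSeries n b)) = 0 := by
    rw [← toSeries_partialDeriv, show partialDeriv e (b : OS n) = 0 from b.2, map_zero, map_zero]
  rw [MvPowerSeries.coeff_pderiv, tsub_add_cancel_of_le
    (by rw [Finsupp.single_le_iff]; omega)] at h1
  exact (mul_eq_zero.mp h1).resolve_right (Nat.cast_add_one_ne_zero _)

theorem exists_independentOf {e : Fin n} {s : MvPowerSeries (Fin n) ℂ} (hs : IsConvergent s)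
    (h : ∀ m : Fin n →₀ ℕ, m e ≠ 0 → MvPowerSeries.coeff m s = 0) :
    ∃ b : independentOf e, toSeries n b = s := by
  refine ⟨⟨ofSeries s hs, ?_⟩, rfl⟩
  apply toSeries_injective
  ext m
  rw [toSeries_partialDeriv, MvPowerSeries.coeff_pderiv, toSeries_ofSeries, h _ (by simp),
    zero_mul, map_zero, map_zero]

/-- The coefficients of `p` are free of `x_e`, so `x^m` can only come from the term of degree `m e`.
-/
theorem coeff_aeval_coord (e : Fin n) (p : (independentOf e)[X]) (m : Fin n →₀ ℕ) :
    MvPowerSeries.coeff m (toSeries n (aeval (coord e) p)) =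
      MvPowerSeries.coeff (m.erase e) (toSeries n (p.coeff (m e))) := by
  classical
  induction p using Polynomial.induction_on' with
  | add p q hp hq => simp only [map_add, hp, hq, coeff_add, Subalgebra.coe_add]
  | monomial j b =>
    rw [aeval_monomial, map_mul, map_pow, toSeries_coord, coeff_mul_X_pow_eq_ite, coeff_monomial]
    rcases lt_trichotomy j (m e) with hj | rfl | hj
    · rw [if_pos hj.le, if_neg hj.ne]
      refine (coeff_eq_zero_of_mem_independentOf b ?_).trans (by simp)
      simp only [Finsupp.coe_tsub, Pi.sub_apply, Finsupp.single_eq_same]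
      omega
    · rw [if_pos le_rfl, if_pos rfl]
      congr 2
      ext i
      by_cases hi : i = e
      · subst hi; simp
      · simp [Finsupp.single_eq_of_ne hi, Finsupp.erase_ne hi]
    · rw [if_neg (by omega), if_neg (by omega)]
      simp

theorem erase_add_single_self (e : Fin n) (m : Fin n →₀ ℕ) :
    m.erase e + Finsupp.single e (m e) = m := by
  rw [add_comm]; exact Finsupp.single_add_erase e m

theorem aeval_coord_injective (e : Fin n) :
    Function.Injective (aeval (R := independentOf e) (coord e)) := by
  rw [injective_iff_map_eq_zero]
  intro p hp
  ext j
  rw [coeff_zero]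
  apply toSeries_injective
  ext m
  rw [Subalgebra.coe_zero, map_zero, map_zero]
  by_cases hm : m e = 0
  · have h1 := coeff_aeval_coord e p (m + Finsupp.single e j)
    rw [hp, map_zero, map_zero] at h1
    have h2 : (m + Finsupp.single e j).erase e = m := by
      ext i
      by_cases hi : i = e
      · subst hi; simp [hm]
      · simp [Finsupp.erase_ne hi]
    simpa [h2, hm] using h1.symm
  · exact coeff_eq_zero_of_mem_independentOf _ hm

theorem exists_aeval_coord_eq {e : Fin n} {d : ℕ} {r : OS n}
    (hr : ∀ m : Fin n →₀ ℕ, d ≤ m e → MvPowerSeries.coeff m (toSeries n r) = 0) :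
    ∃ p : (independentOf e)[X], p.degree < d ∧ aeval (coord e) p = r := by
  -- The coefficient of `x_e^j`: divide by `x_e^j`, then keep the exponent `0` in `x_e`.
  have hb (j : ℕ) : ∃ b : independentOf e, toSeries n b =
      lowPart e 1 (shiftDown e j (toSeries n r)) :=
    exists_independentOf (((isConvergent_toSeries r).shiftDown e j).lowPart e 1)
      fun m hm => by rw [coeff_lowPart, if_neg (by omega)]
  choose b hb using hb
  refine ⟨∑ j ∈ Finset.range d, monomial j (b j), ?_, ?_⟩
  · rw [← Polynomial.mem_degreeLT]
    refine Submodule.sum_mem _ fun j hj => ?_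
    rw [Polynomial.mem_degreeLT]
    exact (degree_monomial_le _ _).trans_lt (by exact_mod_cast Finset.mem_range.mp hj)
  · apply toSeries_injective
    ext m
    have hcoeff : (∑ j ∈ Finset.range d, monomial j (b j)).coeff (m e) =
        if m e < d then b (m e) else 0 := by
      simp [coeff_monomial]
    rw [coeff_aeval_coord, hcoeff]
    split_ifs with hm
    · rw [hb, coeff_lowPart, if_pos (by simp), coeff_shiftDown, erase_add_single_self]
    · rw [hr m (by omega)]
      simp

theorem coeff_aeval_coord_eq_zero {e : Fin n} {d : ℕ} {p : (independentOf e)[X]}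
    (hp : p.degree < d) (m : Fin n →₀ ℕ) (hm : d ≤ m e) :
    MvPowerSeries.coeff m (toSeries n (aeval (coord e) p)) = 0 := by
  rw [coeff_aeval_coord, coeff_eq_zero_of_degree_lt (hp.trans_le (by exact_mod_cast hm))]
  simp

theorem partialDeriv_aeval_coord (e : Fin n) (p : (independentOf e)[X]) :
    partialDeriv e (aeval (coord e) p) = aeval (coord e) (derivative p) := by
  induction p using Polynomial.induction_on' with
  | add p q hp hq => simp only [map_add, hp, hq]
  | monomial j b =>
    have hb : partialDeriv e (algebraMap (independentOf e) (OS n) b) = 0 := b.2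
    rw [aeval_monomial, derivative_monomial, aeval_monomial, Derivation.leibniz,
      Derivation.leibniz_pow, partialDeriv_coord, hb]
    simp [mul_assoc]

/-- The Weierstrass polynomial: `𝒪_S / (h)` is `B[T] / (W)` for a monic polynomial `W` over the
germs `B` that do not depend on `x_e`. -/
theorem IsRegularIn.exists_weierstrass_polynomial {e : Fin n} {d : ℕ} {h : OS n}
    (hreg : IsRegularIn e d h) : ∃ W : (independentOf e)[X], W.Monic ∧
      (∀ p : (independentOf e)[X], h ∣ aeval (coord e) p ↔ W ∣ p) ∧ ∀ a, ∃ p : (independentOf e)[X], h ∣ a - aeval (coord e) p := by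
  have hsurj (a : OS n) : ∃ p : (independentOf e)[X], p.degree < d ∧
      h ∣ a - aeval (coord e) p := by
    obtain ⟨q, r, hqr, hr⟩ := hreg.exists_division a
    obtain ⟨p, hp, rfl⟩ := exists_aeval_coord_eq hr
    exact ⟨p, hp, q, by rw [hqr]; ring⟩
  -- `W` is `T^d` minus the remainder of `x_e^d` on division by `h`.
  obtain ⟨p₀, hp₀, hdvd₀⟩ := hsurj (coord e ^ d)
  have hmonic : (X ^ d - p₀).Monic := monic_X_pow_sub (by simpa using hp₀)
  have hdeg : (X ^ d - p₀).degree = (d : WithBot ℕ) := by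
    rw [degree_sub_eq_left_of_degree_lt] <;> simp [hp₀]
  have hW : h ∣ aeval (coord e) (X ^ d - p₀) := by simpa using hdvd₀
  refine ⟨X ^ d - p₀, hmonic, fun p => ⟨fun hp => ?_, ?_⟩, fun a => ?_⟩
  · rw [← modByMonic_eq_zero_iff_dvd hmonic]
    apply aeval_coord_injective e
    rw [map_zero]
    -- The remainder of `p` by `W` has degree below `d` and is divisible by `h` at `x_e`; uniqueness
    -- of division kills it.
    refine hreg.remainder_eq_zero (coeff_aeval_coord_eq_zero
      ((degree_modByMonic_lt p hmonic).trans_eq hdeg)) ?_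
    rw [modByMonic_eq_sub_mul_div, map_sub, map_mul]
    exact dvd_sub hp (hW.mul_right _)
  · rintro ⟨s, rfl⟩
    rw [map_mul]
    exact hW.mul_right _
  · obtain ⟨p, -, hp⟩ := hsurj a
    exact ⟨p, hp⟩

/-- A monic polynomial over a domain of characteristic zero that generates a radical ideal has no
factor in common with its derivative. -/
theorem dvd_of_dvd_mul_derivative {B : Type*} [CommRing B] [IsDomain B] [CharZero B] {W : B[X]}
    (hW : W.Monic) (hrad : ∀ p, W ∣ p ^ 2 → W ∣ p) {p : B[X]} (hp : W ∣ p * derivative W) :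
    W ∣ p := by
  let K := FractionRing B
  have hinj : Function.Injective (algebraMap B K) := IsFractionRing.injective B K
  have hdvd (p q : B[X]) (hp : p.Monic) :
      p.map (algebraMap B K) ∣ q.map (algebraMap B K) ↔ p ∣ q :=
    map_dvd_map _ hinj hp
  have : CharZero K := charZero_of_injective_algebraMap hinj
  have hsq : Squarefree (W.map (algebraMap B K)) := by
    rintro x ⟨y, hy⟩
    -- If `W = x² y` over `K`, then `W` divides `(x y)²`. Clearing denominators, the radical
    -- hypothesis gives `W ∣ x y`, and cancelling `x y` makes `x` a unit.
    obtain ⟨b, hb, hbz⟩ := IsLocalization.integerNormalization_spec B⁰ (x * y)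
    set z := IsLocalization.integerNormalization B⁰ (x * y)
    have hb0 : IsUnit (C (algebraMap B K b)) :=
      isUnit_C.mpr (IsLocalization.map_units K (⟨b, hb⟩ : B⁰))
    have hbz' : z.map (algebraMap B K) = C (algebraMap B K b) * (x * y) := by
      rw [hbz, Algebra.smul_def, IsScalarTower.algebraMap_apply B K K[X], algebraMap_eq]
    have h1 : W ∣ z := by
      refine hrad z ((hdvd _ _ hW).mp ?_)
      rw [Polynomial.map_pow, hbz', hy]
      exact ⟨C (algebraMap B K b) ^ 2 * y, by ring⟩
    rw [← hdvd _ _ hW, hbz', hb0.dvd_mul_left, hy] at h1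
    have h0 : x * y ≠ 0 := by
      intro h0
      exact (hW.map (algebraMap B K)).ne_zero (by rw [hy, mul_assoc, h0, mul_zero])
    rw [mul_assoc] at h1
    exact isUnit_of_dvd_one ((mul_dvd_mul_iff_right h0).mp (by rwa [one_mul]))
  have hsep := (PerfectField.separable_iff_squarefree.mpr hsq)
  rw [← hdvd _ _ hW] at hp ⊢
  rw [Polynomial.map_mul, ← derivative_map] at hp
  exact IsCoprime.dvd_of_dvd_mul_right hsep hp

/-- If `h` is reduced and regular in `x_e`, then `∂h/∂x_e` is a non-zero divisor modulo `h`. -/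
theorem IsRegularIn.dvd_of_dvd_mul_partialDeriv {e : Fin n} {d : ℕ} {h : OS n}
    (hreg : IsRegularIn e d h) (hrad : ∀ a, h ∣ a ^ 2 → h ∣ a) {a : OS n}
    (ha : h ∣ a * partialDeriv e h) : h ∣ a := by
  obtain ⟨W, hW, hdvd, hsurj⟩ := hreg.exists_weierstrass_polynomial
  obtain ⟨p, hp⟩ := hsurj a
  have : CharZero (independentOf e) :=
    charZero_of_injective_algebraMap (algebraMap ℂ (independentOf e)).injective
  obtain ⟨q, hq⟩ := (hdvd W).mpr dvd_rfl
  -- With `W(x_e) = h q`, modulo `h` one has `W'(x_e) = q ∂h/∂x_e`. So `a ∂h/∂x_e ∈ (h)` gives `W ∣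
  -- p W'`.
  have hWd : aeval (coord e) (derivative W) = h * partialDeriv e q + q * partialDeriv e h := by
    rw [← partialDeriv_aeval_coord, hq, Derivation.leibniz, smul_eq_mul, smul_eq_mul]
  have h1 : W ∣ p := by
    refine dvd_of_dvd_mul_derivative hW (fun s hs => ?_) ?_
    · rw [← hdvd] at hs ⊢
      exact hrad _ (by simpa using hs)
    · rw [← hdvd, map_mul, hWd]
      have h2 : aeval (coord e) p * (h * partialDeriv e q + q * partialDeriv e h) =
          h * (aeval (coord e) p * partialDeriv e q) + q * (a * partialDeriv e h) -
            (a - aeval (coord e) p) * (q * partialDeriv e h) := by ring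
      rw [h2]
      exact dvd_sub (dvd_add (dvd_mul_right _ _) (ha.mul_left _)) (hp.mul_right _)
  simpa using dvd_add hp ((hdvd p).mpr h1)

end WeierstrassPolynomial

/-! ### Linear changes of coordinates -/

section Substitution

open scoped NNReal ENNReal

variable {n : ℕ}

theorem wnorm_one (ρ : Fin n → ℝ≥0) : wnorm ρ (1 : MvPowerSeries (Fin n) ℂ) = 1 := by
  classical
  rw [wnorm, tsum_eq_single 0]
  · simp [monomialWeight]
  · intro m hm
    simp [MvPowerSeries.coeff_one, hm]

theorem wnorm_pow_le (ρ : Fin n → ℝ≥0) (f : MvPowerSeries (Fin n) ℂ) (k : ℕ) :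
    wnorm ρ (f ^ k) ≤ wnorm ρ f ^ k := by
  induction k with
  | zero => rw [pow_zero, pow_zero, wnorm_one]
  | succ k ih =>
    rw [pow_succ, pow_succ]
    exact (wnorm_mul_le _ _ _).trans (by gcongr)

theorem wnorm_prod_le (ρ : Fin n → ℝ≥0) {ι : Type*} (s : Finset ι)
    (f : ι → MvPowerSeries (Fin n) ℂ) : wnorm ρ (∏ i ∈ s, f i) ≤ ∏ i ∈ s, wnorm ρ (f i) := by
  classical
  induction s using Finset.induction_on with
  | empty => rw [Finset.prod_empty, Finset.prod_empty, wnorm_one]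
  | insert i s hi ih =>
    rw [Finset.prod_insert hi, Finset.prod_insert hi]
    exact (wnorm_mul_le _ _ _).trans (by gcongr)

theorem wnorm_zero (ρ : Fin n → ℝ≥0) : wnorm ρ (0 : MvPowerSeries (Fin n) ℂ) = 0 := by
  simp [wnorm]

theorem wnorm_sum_le (ρ : Fin n → ℝ≥0) {ι : Type*} (s : Finset ι)
    (f : ι → MvPowerSeries (Fin n) ℂ) : wnorm ρ (∑ i ∈ s, f i) ≤ ∑ i ∈ s, wnorm ρ (f i) := by
  classical
  induction s using Finset.induction_on with
  | empty => rw [Finset.sum_empty, Finset.sum_empty, wnorm_zero]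
  | insert i s hi ih =>
    rw [Finset.sum_insert hi, Finset.sum_insert hi]
    exact (wnorm_add_le _ _ _).trans (by gcongr)

theorem wnorm_monomial (ρ : Fin n → ℝ≥0) (m : Fin n →₀ ℕ) (c : ℂ) :
    wnorm ρ (MvPowerSeries.monomial m c) = ‖c‖ₑ * monomialWeight ρ m := by
  classical
  rw [wnorm, tsum_eq_single m]
  · rw [MvPowerSeries.coeff_monomial_same]
  · intro k hk
    rw [MvPowerSeries.coeff_monomial, if_neg hk]
    simp

/-- Submultiplicativity bounds the norm of `a^d` by `η^d`; then the two sums of non-negative terms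
are interchanged. -/
theorem wnorm_subst_le {ρ η : Fin n → ℝ≥0} {a : Fin n → MvPowerSeries (Fin n) ℂ}
    (ha : MvPowerSeries.HasSubst a) (haρ : ∀ i, wnorm ρ (a i) ≤ η i)
    (f : MvPowerSeries (Fin n) ℂ) : wnorm ρ (MvPowerSeries.subst a f) ≤ wnorm η f := by
  calc wnorm ρ (MvPowerSeries.subst a f)
      ≤ ∑' m : Fin n →₀ ℕ, ∑' d : Fin n →₀ ℕ, ‖MvPowerSeries.coeff d f‖ₑ *
          (‖MvPowerSeries.coeff m (d.prod fun s k => a s ^ k)‖ₑ * monomialWeight ρ m) := by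
        refine ENNReal.tsum_le_tsum fun m => ?_
        rw [MvPowerSeries.coeff_subst ha,
          finsum_eq_sum _ (MvPowerSeries.coeff_subst_finite ha f m)]
        simp_rw [← mul_assoc]
        rw [ENNReal.tsum_mul_right]
        gcongr
        refine (enorm_sum_le _ _).trans (le_trans (Finset.sum_le_sum fun d _ => ?_)
          (ENNReal.sum_le_tsum _))
        rw [smul_eq_mul, enorm_mul]
    _ = ∑' d : Fin n →₀ ℕ, ‖MvPowerSeries.coeff d f‖ₑ * wnorm ρ (d.prod fun s k => a s ^ k) := by
        rw [ENNReal.tsum_comm]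
        simp_rw [ENNReal.tsum_mul_left]
        rfl
    _ ≤ wnorm η f := by
        refine ENNReal.tsum_le_tsum fun d => ?_
        gcongr
        rw [Finsupp.prod_fintype _ _ fun i => pow_zero _, monomialWeight, ENNReal.ofNNReal_finsetProd]
        refine (wnorm_prod_le _ _ _).trans (Finset.prod_le_prod' fun i _ => ?_)
        rw [ENNReal.coe_pow]
        exact (wnorm_pow_le _ _ _).trans (pow_le_pow_left' (haρ i) _)

/-- The linear form with coefficients `c`. -/
noncomputable def linearForm (c : Fin n → ℂ) : MvPowerSeries (Fin n) ℂ :=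
  ∑ j, c j • MvPowerSeries.X j

theorem constantCoeff_linearForm (c : Fin n → ℂ) :
    MvPowerSeries.constantCoeff (linearForm c) = 0 := by
  simp [linearForm, MvPowerSeries.smul_eq_C_mul]

theorem hasSubst_linearForm (P : Matrix (Fin n) (Fin n) ℂ) :
    MvPowerSeries.HasSubst fun i => linearForm (P i) :=
  MvPowerSeries.hasSubst_of_constantCoeff_zero fun i => constantCoeff_linearForm (P i)

theorem wnorm_linearForm_le (r : ℝ≥0) (c : Fin n → ℂ) :
    wnorm (fun _ => r) (linearForm c) ≤ ((∑ j, ‖c j‖₊) * r : ℝ≥0) := by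
  refine (wnorm_sum_le _ _ _).trans (le_of_eq ?_)
  rw [Finset.sum_mul, ENNReal.ofNNReal_finsetSum]
  refine Finset.sum_congr rfl fun j _ => ?_
  rw [MvPowerSeries.X_def, ← map_smul, wnorm_monomial, monomialWeight_single, ENNReal.coe_mul,
    smul_eq_mul, mul_one, pow_one]
  rfl

theorem isConvergent_subst_linearForm (P : Matrix (Fin n) (Fin n) ℂ)
    {f : MvPowerSeries (Fin n) ℂ} (hf : IsConvergent f) :
    IsConvergent (MvPowerSeries.subst (fun i => linearForm (P i)) f) := by
  rw [isConvergent_iff_wnorm_lt_top] at hf ⊢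
  obtain ⟨s, hs, hf⟩ := hf
  -- A bound for all row sums of `P`, made positive by the `1`.
  let K : ℝ≥0 := 1 + ∑ i, ∑ j, ‖P i j‖₊
  have hK : 0 < K := add_pos_of_pos_of_nonneg one_pos (by positivity)
  refine ⟨s / K, div_pos hs hK, (wnorm_subst_le (hasSubst_linearForm P) (fun i => ?_) f).trans_lt
    hf⟩
  refine (wnorm_linearForm_le _ _).trans (ENNReal.coe_le_coe.mpr ?_)
  calc (∑ j, ‖P i j‖₊) * (s / K) ≤ K * (s / K) := by
        gcongr
        exact (Finset.single_le_sum (f := fun i => ∑ j, ‖P i j‖₊) (fun _ _ => by positivity)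
          (Finset.mem_univ i)).trans le_add_self
    _ = s := mul_div_cancel₀ _ hK.ne'

/-- The linear substitution `xᵢ ↦ ∑ⱼ Pᵢⱼ xⱼ`. -/
noncomputable def linearSubst (P : Matrix (Fin n) (Fin n) ℂ) : OS n →ₐ[ℂ] OS n :=
  AlgHom.codRestrict ((MvPowerSeries.substAlgHom (R := ℂ) (hasSubst_linearForm P)).comp
    (convergentPowerSeries n).val) (convergentPowerSeries n) fun f => by
      rw [AlgHom.comp_apply, MvPowerSeries.substAlgHom_apply]
      exact isConvergent_subst_linearForm P f.2

theorem toSeries_linearSubst (P : Matrix (Fin n) (Fin n) ℂ) (f : OS n) :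
    toSeries n (linearSubst P f) =
      MvPowerSeries.subst (fun i => linearForm (P i)) (toSeries n f) :=
  MvPowerSeries.substAlgHom_apply (hasSubst_linearForm P) _

theorem linearSubst_coord (P : Matrix (Fin n) (Fin n) ℂ) (i : Fin n) :
    linearSubst P (coord i) = ∑ j, P i j • coord j := by
  apply toSeries_injective
  rw [toSeries_linearSubst, toSeries_coord, MvPowerSeries.subst_X (hasSubst_linearForm P)]
  simp only [map_sum, map_smul, toSeries_coord, linearForm]

/-- Pulling back functions is contravariant, hence the reversed product. -/
theorem linearSubst_comp (P Q : Matrix (Fin n) (Fin n) ℂ) :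
    (linearSubst P).comp (linearSubst Q) = linearSubst (Q * P) := by
  refine (algHom_ext_of_coord (fun i => ?_) fun i => ?_).symm
  · rw [toSeries_linearSubst, toSeries_coord, MvPowerSeries.subst_X (hasSubst_linearForm _)]
    exact constantCoeff_linearForm _
  · simp only [AlgHom.comp_apply, linearSubst_coord, map_sum, map_smul, Finset.smul_sum,
      Matrix.mul_apply, Finset.sum_smul, mul_smul]
    exact Finset.sum_comm

theorem linearSubst_one : linearSubst (1 : Matrix (Fin n) (Fin n) ℂ) = AlgHom.id ℂ (OS n) := by
  refine algHom_ext_of_coord (fun i => ?_) fun i => ?_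
  · rw [toSeries_linearSubst, toSeries_coord, MvPowerSeries.subst_X (hasSubst_linearForm _)]
    exact constantCoeff_linearForm _
  · rw [linearSubst_coord]
    simp [Matrix.one_apply]

/-- The restriction of a power series to the `x_e`-axis. -/
noncomputable def alongAxis (e : Fin n) : MvPowerSeries (Fin n) ℂ →+* PowerSeries ℂ where
  toFun f := PowerSeries.mk fun j => MvPowerSeries.coeff (Finsupp.single e j) f
  map_zero' := by ext; simp
  map_one' := by
    classical
    ext j
    simp [MvPowerSeries.coeff_one, PowerSeries.coeff_one]
  map_add' f g := by ext; simp
  map_mul' f g := by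
    classical
    ext j
    rw [PowerSeries.coeff_mk, PowerSeries.coeff_mul, MvPowerSeries.coeff_mul,
      Finsupp.antidiagonal_single, Finset.sum_map]
    simp

theorem coeff_alongAxis (e : Fin n) (f : MvPowerSeries (Fin n) ℂ) (j : ℕ) :
    PowerSeries.coeff j (alongAxis e f) = MvPowerSeries.coeff (Finsupp.single e j) f := by
  simp [alongAxis]

theorem alongAxis_linearForm (e : Fin n) (c : Fin n → ℂ) :
    alongAxis e (linearForm c) = PowerSeries.C (c e) * PowerSeries.X := by
  classical
  ext j
  rw [coeff_alongAxis, linearForm, map_sum, PowerSeries.coeff_C_mul, PowerSeries.coeff_X,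
    Finset.sum_eq_single e]
  · rw [MvPowerSeries.coeff_smul, MvPowerSeries.coeff_X]
    simp [(Finsupp.single_injective e).eq_iff]
  · intro i _ hi
    rw [MvPowerSeries.coeff_smul, MvPowerSeries.coeff_X, if_neg, mul_zero]
    intro h
    have := DFunLike.congr_fun h i
    simp [Finsupp.single_eq_of_ne hi] at this
  · simp

/-- On the `x_e`-axis the `i`-th linear form is `P i e` times `x_e`. The result is thus the
homogeneous part of degree `j` evaluated at the `e`-th column of `P`. -/
theorem coeff_single_subst_linearForm (P : Matrix (Fin n) (Fin n) ℂ) (e : Fin n) (j : ℕ)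
    (f : MvPowerSeries (Fin n) ℂ) :
    MvPowerSeries.coeff (Finsupp.single e j)
        (MvPowerSeries.subst (fun i => linearForm (P i)) f) =
      ∑ᶠ d : Fin n →₀ ℕ, if d.degree = j then
        MvPowerSeries.coeff d f * ∏ i, P i e ^ d i else 0 := by
  rw [MvPowerSeries.coeff_subst (hasSubst_linearForm P)]
  refine finsum_congr fun d => ?_
  rw [← coeff_alongAxis, Finsupp.prod_fintype _ _ fun i => pow_zero _]
  simp only [map_prod, map_pow, alongAxis_linearForm, mul_pow, Finset.prod_mul_distrib,
    Finset.prod_pow_eq_pow_sum, ← Finsupp.degree_eq_sum]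
  have hC : ∏ i, PowerSeries.C (P i e) ^ d i = PowerSeries.C (∏ i, P i e ^ d i) := by
    simp only [map_prod, map_pow]
  rw [hC, PowerSeries.coeff_C_mul, PowerSeries.coeff_X_pow]
  split_ifs <;> simp_all

/-- The initial form of `h` is a non-zero polynomial over an infinite field, so it is non-zero at
some `v`; send the `e`-th axis to the direction `v`. -/
theorem exists_isRegularIn_linearSubst {h : OS n} (hh : h ≠ 0) (e : Fin n) :
    ∃ (P : Matrix (Fin n) (Fin n) ℂ) (d : ℕ), IsUnit P.det ∧
      IsRegularIn e d (linearSubst P h) := by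
  classical
  have hh' : toSeries n h ≠ 0 := by
    rwa [Ne, map_eq_zero_iff _ toSeries_injective]
  have hord := MvPowerSeries.ne_zero_iff_order_finite.mp hh'
  obtain ⟨m, hm, hmd⟩ := MvPowerSeries.exists_coeff_ne_zero_and_order hord
  set d := (toSeries n h).order.toNat with hd
  have hmd' : m.degree = d := by
    rw [← hord] at hmd
    exact_mod_cast hmd
  have hlow (k : Fin n →₀ ℕ) (hk : k.degree < d) : MvPowerSeries.coeff k (toSeries n h) = 0 := by
    refine MvPowerSeries.coeff_of_lt_order ?_
    rw [← hord]
    exact_mod_cast hk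
  have hfin : {k : Fin n →₀ ℕ | k.degree = d}.Finite :=
    (Finsupp.finite_of_degree_le d).subset fun k hk => le_of_eq hk
  let p : MvPolynomial (Fin n) ℂ :=
    ∑ k ∈ hfin.toFinset, MvPolynomial.monomial k (MvPowerSeries.coeff k (toSeries n h))
  have hp : p ≠ 0 := by
    intro h0
    apply hm
    have := congrArg (MvPolynomial.coeff m) h0
    simpa [p, MvPolynomial.coeff_sum, MvPolynomial.coeff_monomial, hmd'] using this
  -- The factor `X e` ensures `v e ≠ 0`, which is the determinant of the matrix `P` below.
  obtain ⟨v, hv⟩ : ∃ v, MvPolynomial.eval v (p * MvPolynomial.X e) ≠ 0 := by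
    by_contra! hcon
    exact mul_ne_zero hp (MvPolynomial.X_ne_zero e)
      (MvPolynomial.funext fun v => by rw [hcon v, map_zero])
  rw [map_mul, MvPolynomial.eval_X] at hv
  let P : Matrix (Fin n) (Fin n) ℂ := (1 : Matrix (Fin n) (Fin n) ℂ).updateCol e v
  have hPe (i : Fin n) : P i e = v i := by simp [P]
  refine ⟨P, d, ?_, fun j hj => ?_, ?_⟩
  · rw [← Matrix.cramer_apply, Matrix.cramer_one]
    exact (right_ne_zero_of_mul hv).isUnit
  · rw [toSeries_linearSubst, coeff_single_subst_linearForm]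
    refine finsum_eq_zero_of_forall_eq_zero fun k => ?_
    split_ifs with hk
    · rw [hlow k (by omega), zero_mul]
    · rfl
  · rw [toSeries_linearSubst, coeff_single_subst_linearForm,
      finsum_eq_sum_of_support_subset (s := hfin.toFinset)]
    · refine ne_of_eq_of_ne ?_ (left_ne_zero_of_mul hv)
      rw [map_sum]
      refine Finset.sum_congr rfl fun k hk => ?_
      rw [if_pos (by simpa using hk), MvPolynomial.eval_monomial,
        Finsupp.prod_fintype _ _ fun i => pow_zero _]
      simp only [hPe]
    · intro k hk
      simp only [Function.mem_support, ne_eq, ite_eq_right_iff, Classical.not_imp] at hk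
      simpa using hk.1

/-- The chain rule for a linear change of coordinates. -/
theorem partialDeriv_linearSubst {P : Matrix (Fin n) (Fin n) ℂ} (hP : IsUnit P.det) (e : Fin n)
    (h : OS n) : partialDeriv e (linearSubst P h) =
      linearSubst P (∑ i, algebraMap ℂ (OS n) (P i e) * partialDeriv i h) := by
  have h1 (f : OS n) : linearSubst P (linearSubst P⁻¹ f) = f := by
    rw [← AlgHom.comp_apply, linearSubst_comp, Matrix.nonsing_inv_mul P hP, linearSubst_one,
      AlgHom.id_apply]
  have h2 (f : OS n) : linearSubst P⁻¹ (linearSubst P f) = f := by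
    rw [← AlgHom.comp_apply, linearSubst_comp, Matrix.mul_nonsing_inv P hP, linearSubst_one,
      AlgHom.id_apply]
  -- The conjugate of `∂/∂x_e` by the substitution is again a derivation, hence determined by its
  -- values on the coordinates.
  let D : Derivation ℂ (OS n) (OS n) := Derivation.mk'
    ((linearSubst P⁻¹).toLinearMap ∘ₗ (partialDeriv e).toLinearMap ∘ₗ (linearSubst P).toLinearMap)
    fun f g => by
      simp [Derivation.leibniz, h2]
  have hD (f : OS n) : D f = linearSubst P⁻¹ (partialDeriv e (linearSubst P f)) := rfl
  have hcoord (i : Fin n) : D (coord i) = algebraMap ℂ (OS n) (P i e) := by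
    have hsum : partialDeriv e (∑ j, P i j • coord j) =
        ∑ j, P i j • partialDeriv e (coord j) := by
      rw [map_sum]
      exact Finset.sum_congr rfl fun j _ => (partialDeriv e).map_smul _ _
    rw [hD, linearSubst_coord, hsum]
    simp [partialDeriv_coord, Algebra.algebraMap_eq_smul_one]
  rw [← h1 (partialDeriv e _), ← hD, derivation_eq_sum D, ← Derivation.coeFnAddMonoidHom_apply,
    map_sum, Finset.sum_apply]
  simp [hcoord, Algebra.smul_def]

/-- If `h ≠ 0` is reduced, some directional derivative of `h` is a non-zero divisor modulo `h`. -/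
theorem exists_directional_derivative (e : Fin n) {h : OS n} (hh : h ≠ 0)
    (hrad : ∀ a, h ∣ a ^ 2 → h ∣ a) :
    ∃ v : Fin n → OS n, ∀ a, h ∣ a * ∑ i, v i * partialDeriv i h → h ∣ a := by
  obtain ⟨P, d, hP, hreg⟩ := exists_isRegularIn_linearSubst hh e
  have h1 (f : OS n) : linearSubst P (linearSubst P⁻¹ f) = f := by
    rw [← AlgHom.comp_apply, linearSubst_comp, Matrix.nonsing_inv_mul P hP, linearSubst_one,
      AlgHom.id_apply]
  have h2 (f : OS n) : linearSubst P⁻¹ (linearSubst P f) = f := by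
    rw [← AlgHom.comp_apply, linearSubst_comp, Matrix.mul_nonsing_inv P hP, linearSubst_one,
      AlgHom.id_apply]
  have hdvd (a : OS n) : linearSubst P h ∣ linearSubst P a ↔ h ∣ a :=
    ⟨fun hd => by simpa only [h2] using map_dvd (linearSubst P⁻¹) hd, fun hd => map_dvd _ hd⟩
  refine ⟨fun i => algebraMap ℂ (OS n) (P i e), fun a ha => ?_⟩
  rw [← hdvd] at ha ⊢
  rw [map_mul, ← partialDeriv_linearSubst hP] at ha
  -- Reducedness is transported along the automorphism.
  refine hreg.dvd_of_dvd_mul_partialDeriv (fun b hb => ?_) ha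
  rw [← h1 b] at hb ⊢
  rw [← map_pow, hdvd] at hb
  exact (hdvd _).mpr (hrad _ hb)

theorem isUnit_of_dimension_zero {h : OS 0} (hh : h ≠ 0) : IsUnit h := by
  obtain ⟨c, u, rfl⟩ := exists_eq_algebraMap_add_sum_coord_mul h
  rw [Finset.univ_eq_empty, Finset.sum_empty, add_zero] at hh ⊢
  refine (IsUnit.mk0 c ?_).map _
  rintro rfl
  exact hh (map_zero _)

end Substitution

end LogResidue

/-! ### Conclusion -/

theorem corollary3p6 (n : ℕ) (h : LogResidue.OS n) (hh : h ≠ 0)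
    (hred : IsReduced (LogResidue.OD h)) (hfree : LogResidue.IsFreeDivisor h) :
    LogResidue.IsFractionalIdealOn h (LogResidue.jacobianModule h) ∧
    LogResidue.IsFractionalIdealOn h (LogResidue.residueModule h) ∧
    LogResidue.jacobianModule h = LogResidue.dual h (LogResidue.residueModule h) := by
  have hrad (a : LogResidue.OS n) (ha : h ∣ a ^ 2) : h ∣ a := by
    rw [← Ideal.Quotient.eq_zero_iff_dvd] at ha ⊢
    rw [map_pow] at ha
    exact pow_eq_zero_iff two_ne_zero |>.mp ha
  obtain ⟨v, hv⟩ : ∃ v : Fin n → LogResidue.OS n,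
      ∀ a, h ∣ a * ∑ i, v i * LogResidue.partialDeriv i h → h ∣ a := by
    -- Without variables there is no axis to choose, but then `h` is a unit and `𝒪_D = 0`.
    cases n with
    | zero => exact ⟨0, fun a _ => (LogResidue.isUnit_of_dimension_zero hh).dvd⟩
    | succ n => exact LogResidue.exists_directional_derivative 0 hh hrad
  refine LogResidue.jacobianModule_eq_dual_of_free_relations hh v ?_ ?_
  · rw [LogResidue.isUnit_restrict_iff, mem_nonZeroDivisors_iff_right]
    intro x hx
    obtain ⟨a, rfl⟩ := Ideal.Quotient.mk_surjective x
    rw [← map_mul, Ideal.Quotient.eq_zero_iff_dvd] at hx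
    exact (Ideal.Quotient.eq_zero_iff_dvd _ _).mpr (hv a hx)
  · have : Module.Free (LogResidue.OS n) (LogResidue.logDer h) := hfree
    exact Module.Free.of_equiv (LogResidue.logDerEquiv h)
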